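/- Let $B_0\in\mathbb{C}^{n\times n}$, let $\tau_0\in(\mathbb{Z}/2\mathbb{Z})^n$, and fix a minimal realization of $B_0$: a vector space $\mathfrak h$ of dimension $2n-\operatorname{rk}B_0$ with linearly independent $\alpha_1,\dots,\alpha_n\in\mathfrak h^*$ and linearly independent $h_1,\dots,h_n\in\mathfrak h$ such that $\alpha_j(h_i)=(B_0)_{ij}$. Let $\tilde{\mathfrak g}$ be the complex Lie superalgebra generated by $\mathfrak h$ (even) and $e_i,f_i$ (of parity $(\tau_0)_i$) with relations $[h,h']=0$, $[h,e_i]=\alpha_i(h)e_i$, $[h,f_i]=-\alpha_i(h)f_i$, $[e_i,f_j]=\delta_{ij}h_i$, and let $\mathfrak g=\mathfrak g(B_0,\tau_0)$ be the quotient of $\tilde{\mathfrak g}$ by its maximal ideal intersecting $\mathfrak h$ trivially. An *ordered root base* of $\mathfrak g$ is a sequence $\Pi=(\beta_1,\dots,\beta_n)$ of linearly independent roots for which there are *Chevalley generators* $e_i\in\mathfrak g_{\beta_i}$, $f_i\in\mathfrak g_{-\beta_i}$ which together with $\mathfrak h$ generate $\mathfrak g$ and satisfy $[e_i,f_j]=0$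 for $i\ne j$. A choice of Chevalley generators determines the *Cartan datum* $(B,\tau)$ with $\tau_i=|e_i|$ and $b_{ij}=\beta_j(h_i)$, where the coroot $h_i$ is $[e_i,f_i]\in\mathfrak h$; by rescaling the generators, $B$ is changed by non-zero scalars on its rows. The simple root $\beta_i$ is *odd isotropic* if it is odd and $\beta_i(h_i)=0$. In this case the *odd reflection* of $\Pi$ at $\beta_i$ is the sequence $\Pi'=(\beta'_1,\dots,\beta'_n)$ with $\beta'_i=-\beta_i$ and, for $j\neq i$, $\beta'_j=\beta_j$ if $\beta_j(h_i)=0$ and $\beta'_j=\beta_j+\beta_i$ if $\beta_j(h_i)\ne0$. A Cartan datum $(B,\tau)$ is *symmetrizable* if $B$ becomes symmetric after multiplying its rows by suitable non-zero scalars. **Proposition.** (1) Let $\Pi$ be an ordered root base of $\mathfrak g$, let $\beta_i\in\Pi$ be odd isotropic, and let $\Pi'$ be obtained from $\Pi$ by odd reflection at $\beta_i$. Suppose there are Chevalley generators for $\Pi$ such that in the resulting Cartan datum $(B,\tau)$ the matrix $B$ is symmetric. Then $\Pi'$ is an ordered root base, and there is a choice of Chevalley generators for $\Pi'$ such that the corresponding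 Cartan datum $(B',\tau')$ is given by $$b'_{jk}=\begin{cases}-b_{jk}&\text{if }j=i\text{ or }k=i,\\ b_{jk}&\text{if }j,k\neq i,\ b_{ji}b_{ik}=0,\\ b_{jk}+b_{ik}+b_{ji}&\text{if }j,k\neq i,\ b_{ji}b_{ik}\neq0,\end{cases}\qquad \tau'_j=\begin{cases}\tau_j&\text{if }b_{ij}=0,\\ \tau_j+\bar1&\text{if }b_{ij}\neq0.\end{cases}$$ (2) If some Chevalley generators for an ordered root base $\Pi$ have a symmetrizable Cartan datum, and $\Pi'$ is obtained from $\Pi$ by a finite sequence of odd reflections, then $\Pi'$ is an ordered root base, and the Cartan datum of every choice of Chevalley generators for $\Pi'$ is symmetrizable. -/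

import Mathlib

noncomputable section

/-! ## Lie superalgebras over `ℂ` -/

/-- The Koszul sign `(-1)^(ab)` of two parities. -/
def superSign (a b : ZMod 2) : ℂ := (-1) ^ (a.val * b.val)

/-- A complex Lie superalgebra: a `ℤ/2`-graded vector space with an even bilinear bracket that is
super skew-symmetric and satisfies the super Jacobi identity. -/
class LieSuperalgebra (L : Type*) [AddCommGroup L] [Module ℂ L] where
  part : ZMod 2 → Submodule ℂ L
  isCompl_part : IsCompl (part 0) (part 1)
  bracket : L →ₗ[ℂ] L →ₗ[ℂ] L
  bracket_mem : ∀ {a b : ZMod 2} {x y : L}, x ∈ part a → y ∈ part b → bracket x y ∈ part (a + b)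
  skew : ∀ {a b : ZMod 2} {x y : L}, x ∈ part a → y ∈ part b →
    bracket x y = -(superSign a b • bracket y x)
  jacobi : ∀ {a b : ZMod 2} {x y z : L}, x ∈ part a → y ∈ part b →
    bracket x (bracket y z) = bracket (bracket x y) z + superSign a b • bracket y (bracket x z)

namespace LieSuperalgebra

/-- Graded subspaces induce a direct sum decomposition of the quotient. -/
theorem isCompl_map_mkQ {V : Type*} [AddCommGroup V] [Module ℂ V] {p q S : Submodule ℂ V}
    (h : IsCompl p q) (hS : S ≤ (S ⊓ p) ⊔ (S ⊓ q)) :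
    IsCompl (p.map S.mkQ) (q.map S.mkQ) := by
  constructor
  · rw [Submodule.disjoint_def]
    rintro _ ⟨x, hx, rfl⟩ ⟨y, hy, hxy⟩
    have hmem : x - y ∈ S := by
      rw [← Submodule.Quotient.mk_eq_zero, Submodule.Quotient.mk_sub, sub_eq_zero]
      exact hxy.symm
    obtain ⟨u, ⟨huS, hup⟩, v, ⟨hvS, hvq⟩, huv⟩ := Submodule.mem_sup.1 (hS hmem)
    have h1 : x - u ∈ p := p.sub_mem hx hup
    have h2 : x - u ∈ q := by
      have : x - u = y + v := by
        have : x = (u + v) + y := by rw [huv]; abel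
        rw [this]; abel
      rw [this]; exact q.add_mem hy hvq
    have h3 : x - u = 0 := Submodule.disjoint_def.1 h.disjoint _ h1 h2
    rw [sub_eq_zero.1 h3]
    exact (Submodule.Quotient.mk_eq_zero S).2 huS
  · rw [codisjoint_iff, ← Submodule.map_sup, h.sup_eq_top, Submodule.map_top, Submodule.range_mkQ]

variable {L : Type*} [AddCommGroup L] [Module ℂ L] [LieSuperalgebra L]

/-- Graded ideals of a Lie superalgebra. -/
structure IsGradedIdeal (S : Submodule ℂ L) : Prop where
  bracket_mem : ∀ x : L, ∀ y ∈ S, bracket x y ∈ S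
  graded : S ≤ (S ⊓ part 0) ⊔ (S ⊓ part 1)

theorem IsGradedIdeal.bracket_mem_left {S : Submodule ℂ L} (hS : IsGradedIdeal S) (x : L)
    (hx : x ∈ S) (y : L) : bracket x y ∈ S := by
  have key : ∀ a b : ZMod 2, ∀ u ∈ S ⊓ part a, ∀ v ∈ part (L := L) b, bracket u v ∈ S := by
    intro a b u hu v hv
    rw [skew hu.2 hv]
    exact S.neg_mem (S.smul_mem _ (hS.bracket_mem _ _ hu.1))
  have hy : y ∈ part (L := L) 0 ⊔ part 1 := by
    rw [(isCompl_part (L := L)).sup_eq_top]; trivial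
  obtain ⟨x0, hx0, x1, hx1, rfl⟩ := Submodule.mem_sup.1 (hS.graded hx)
  obtain ⟨y0, hy0, y1, hy1, rfl⟩ := Submodule.mem_sup.1 hy
  simp only [map_add, LinearMap.add_apply]
  exact S.add_mem (S.add_mem (key _ _ _ hx0 _ hy0) (key _ _ _ hx1 _ hy0))
    (S.add_mem (key _ _ _ hx0 _ hy1) (key _ _ _ hx1 _ hy1))

theorem isGradedIdeal_sSup {s : Set (Submodule ℂ L)} (hs : ∀ S ∈ s, IsGradedIdeal S) :
    IsGradedIdeal (sSup s) where
  bracket_mem x y hy := by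
    have : sSup s ≤ (sSup s).comap (bracket x) :=
      sSup_le fun S hS z hz => (le_sSup hS : S ≤ sSup s) ((hs S hS).bracket_mem x z hz)
    exact this hy
  graded := sSup_le fun S hS => (hs S hS).graded.trans
    (sup_le_sup (inf_le_inf_right _ (le_sSup hS)) (inf_le_inf_right _ (le_sSup hS)))

/-- The bracket induced on the quotient by a subspace stable under brackets on both sides. -/
def quotientBracket {V : Type*} [AddCommGroup V] [Module ℂ V] (m : V →ₗ[ℂ] V →ₗ[ℂ] V)
    (S : Submodule ℂ V) (h₁ : ∀ x, ∀ y ∈ S, m x y ∈ S) (h₂ : ∀ x ∈ S, ∀ y, m x y ∈ S) :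
    (V ⧸ S) →ₗ[ℂ] (V ⧸ S) →ₗ[ℂ] (V ⧸ S) :=
  S.liftQ
    { toFun := fun x => S.mapQ S (m x) (fun y hy => h₁ x y hy)
      map_add' := fun x y => by ext z; simp
      map_smul' := fun c x => by ext z; simp }
    (fun x hx => by
      rw [LinearMap.mem_ker]
      ext z
      simpa using h₂ x hx z)

@[simp] theorem quotientBracket_mk {V : Type*} [AddCommGroup V] [Module ℂ V]
    (m : V →ₗ[ℂ] V →ₗ[ℂ] V) (S : Submodule ℂ V) (h₁ : ∀ x, ∀ y ∈ S, m x y ∈ S)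
    (h₂ : ∀ x ∈ S, ∀ y, m x y ∈ S) (x y : V) :
    quotientBracket m S h₁ h₂ (S.mkQ x) (S.mkQ y) = S.mkQ (m x y) := rfl

/-- The quotient of a Lie superalgebra by a graded ideal. -/
@[reducible] def quotient (S : Submodule ℂ L) (hS : IsGradedIdeal S) : LieSuperalgebra (L ⧸ S) where
  part a := (part a).map S.mkQ
  isCompl_part := isCompl_map_mkQ isCompl_part hS.graded
  bracket := quotientBracket bracket S hS.bracket_mem hS.bracket_mem_left
  bracket_mem := by
    rintro a b _ _ ⟨x, hx, rfl⟩ ⟨y, hy, rfl⟩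
    exact ⟨_, bracket_mem hx hy, rfl⟩
  skew := by
    rintro a b _ _ ⟨x, hx, rfl⟩ ⟨y, hy, rfl⟩
    rw [quotientBracket_mk, quotientBracket_mk, ← map_smul, ← map_neg, skew hx hy]
  jacobi := by
    rintro a b _ _ z ⟨x, hx, rfl⟩ ⟨y, hy, rfl⟩
    obtain ⟨z, rfl⟩ := S.mkQ_surjective z
    simp only [quotientBracket_mk]
    rw [← map_smul, ← map_add, jacobi hx hy]

/-- The set `s` generates `L` as a Lie superalgebra: the only subspace which contains `s` and is
closed under the bracket is `L`. -/
def Generates (s : Set L) : Prop :=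
  ∀ S : Submodule ℂ L, s ⊆ S → (∀ x ∈ S, ∀ y ∈ S, bracket x y ∈ S) → S = ⊤

end LieSuperalgebra

open LieSuperalgebra

/-! ## Cartan data and minimal realizations -/

/-- A Cartan datum `(B, τ)`: a complex square matrix and a parity vector. -/
structure CartanDatum (n : ℕ) where
  B : Matrix (Fin n) (Fin n) ℂ
  τ : Fin n → ZMod 2

namespace CartanDatum

/-- `B` is symmetrizable: it becomes symmetric after rescaling its rows by non-zero scalars. -/
def IsSymmetrizable {n : ℕ} (C : CartanDatum n) : Prop :=
  ∃ d : Fin n → ℂ, (∀ j, d j ≠ 0) ∧ (Matrix.diagonal d * C.B).IsSymm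

open Classical in
/-- The explicit effect of the odd reflection at the index `i` on a symmetric Cartan datum. -/
def oddReflection {n : ℕ} (C : CartanDatum n) (i : Fin n) : CartanDatum n where
  B := Matrix.of fun j k =>
    if j = i ∨ k = i then -C.B j k
    else if C.B j i * C.B i k = 0 then C.B j k
    else C.B j k + C.B i k + C.B j i
  τ := fun j => if C.B i j = 0 then C.τ j else C.τ j + 1

end CartanDatum

/-- A minimal realization of the square matrix `B` on the complex vector space `H`. -/
structure MinimalRealization {n : ℕ} (B : Matrix (Fin n) (Fin n) ℂ) (H : Type*) [AddCommGroup H]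
    [Module ℂ H] where
  root : Fin n → Module.Dual ℂ H
  coroot : Fin n → H
  linearIndependent_root : LinearIndependent ℂ root
  linearIndependent_coroot : LinearIndependent ℂ coroot
  root_coroot : ∀ i j, root j (coroot i) = B i j
  finiteDimensional : FiniteDimensional ℂ H
  finrank_add_rank : Module.finrank ℂ H + B.rank = 2 * n

/-! ## The Lie superalgebra `g̃(B, τ)` by generators and relations -/

namespace Contragredient

/-- The generators: the elements of `H`, the `e i` and the `f i`. -/
inductive Gen (n : ℕ) (H : Type*)
  | h : H → Gen n H
  | e : Fin n → Gen n H
  | f : Fin n → Gen n H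

section Free

variable {n : ℕ} (τ : Fin n → ZMod 2) {H : Type*}

/-- The parity of a generator. -/
def genParity : Gen n H → ZMod 2
  | .h _ => 0
  | .e i => τ i
  | .f i => τ i

/-- The parity of a non-associative word in the generators. -/
def wordParity : FreeMagma (Gen n H) → ZMod 2
  | .of x => genParity τ x
  | .mul u v => wordParity u + wordParity v

variable (n H) in
/-- The free non-associative algebra on the generators. -/
abbrev Free : Type _ := FreeNonUnitalNonAssocAlgebra ℂ (Gen n H)

/-- The subspace of the free non-associative algebra spanned by the words of parity `a`. -/
def freePart (a : ZMod 2) : Submodule ℂ (Free n H) :=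
  Submodule.span ℂ (MonoidAlgebra.ofMagma ℂ (FreeMagma (Gen n H)) '' {w | wordParity τ w = a})

theorem coeff_eq_zero {a : ZMod 2} {x : Free n H} (hx : x ∈ freePart τ a)
    (w : FreeMagma (Gen n H)) (hw : wordParity τ w ≠ a) : x.coeff w = 0 := by
  induction hx using Submodule.span_induction with
  | mem x hx =>
    obtain ⟨v, hv, rfl⟩ := hx
    have : v ≠ w := by rintro rfl; exact hw hv
    simp [MonoidAlgebra.ofMagma, MonoidAlgebra.coeff_single, this]
  | zero => simp
  | add x y _ _ h1 h2 => simp [h1, h2]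
  | smul c x _ h => simp [h]

theorem isCompl_freePart : IsCompl (freePart τ (H := H) 0) (freePart τ 1) := by
  constructor
  · rw [Submodule.disjoint_def]
    intro x h0 h1
    ext w
    by_cases h : wordParity τ w = 0
    · exact coeff_eq_zero τ h1 w (by rw [h]; decide)
    · exact coeff_eq_zero τ h0 w h
  · rw [codisjoint_iff, eq_top_iff]
    intro x _
    have hone : ∀ (w : FreeMagma (Gen n H)) (c : ℂ),
        MonoidAlgebra.single w c ∈ freePart τ (H := H) 0 ⊔ freePart τ 1 := by
      intro w c
      have h : MonoidAlgebra.single w c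
          = c • MonoidAlgebra.ofMagma ℂ (FreeMagma (Gen n H)) w := by
        simp [MonoidAlgebra.ofMagma]
      rw [h]
      refine Submodule.smul_mem _ _ ?_
      have h01 : ∀ a : ZMod 2, a = 0 ∨ a = 1 := by decide
      rcases h01 (wordParity τ w) with h | h
      · exact Submodule.mem_sup_left (Submodule.subset_span ⟨w, h, rfl⟩)
      · exact Submodule.mem_sup_right (Submodule.subset_span ⟨w, h, rfl⟩)
    induction x using MonoidAlgebra.induction_linear with
    | zero => exact Submodule.zero_mem _
    | add x y hx hy => exact Submodule.add_mem _ (hx trivial) (hy trivial)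
    | single w c => exact hone w c

theorem mul_mem_freePart {a b : ZMod 2} {x y : Free n H} (hx : x ∈ freePart τ a)
    (hy : y ∈ freePart τ b) : x * y ∈ freePart τ (a + b) := by
  induction hx using Submodule.span_induction with
  | mem x hx =>
    induction hy using Submodule.span_induction with
    | mem y hy =>
      obtain ⟨u, rfl, rfl⟩ := hx
      obtain ⟨v, rfl, rfl⟩ := hy
      exact Submodule.subset_span ⟨u * v, rfl, map_mul _ _ _⟩
    | zero => rw [mul_zero]; exact Submodule.zero_mem _
    | add y z _ _ h1 h2 => rw [mul_add]; exact Submodule.add_mem _ h1 h2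
    | smul c y _ h => rw [mul_smul_comm]; exact Submodule.smul_mem _ _ h
  | zero => rw [zero_mul]; exact Submodule.zero_mem _
  | add x z _ _ h1 h2 => rw [add_mul]; exact Submodule.add_mem _ h1 h2
  | smul c x _ h => rw [smul_mul_assoc]; exact Submodule.smul_mem _ _ h

variable (n) in
/-- The generator of the free algebra attached to an element of `H`. -/
def freeH (h : H) : Free n H := FreeNonUnitalNonAssocAlgebra.of ℂ (.h h)

variable (H) in
/-- The generator `e i` of the free algebra. -/
def freeE (i : Fin n) : Free n H := FreeNonUnitalNonAssocAlgebra.of ℂ (.e i)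

variable (H) in
/-- The generator `f i` of the free algebra. -/
def freeF (i : Fin n) : Free n H := FreeNonUnitalNonAssocAlgebra.of ℂ (.f i)

theorem of_mem_freePart (x : Gen n H) :
    FreeNonUnitalNonAssocAlgebra.of ℂ x ∈ freePart τ (genParity τ x) :=
  Submodule.subset_span ⟨FreeMagma.of x, rfl, rfl⟩

end Free

variable {n : ℕ} {B : Matrix (Fin n) (Fin n) ℂ} {H : Type*} [AddCommGroup H] [Module ℂ H]
  (R : MinimalRealization B H) (τ : Fin n → ZMod 2)

/-- The relations of `g̃(B, τ)`, each expressed as an element of the free algebra which has to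
vanish: linearity in `H`, the axioms of a Lie superalgebra, and the defining relations. -/
inductive Relator : Free n H → Prop
  | linear (c : ℂ) (h h' : H) : Relator (freeH n (c • h + h') - (c • freeH n h + freeH n h'))
  | skew {a b : ZMod 2} {x y : Free n H} (hx : x ∈ freePart τ a) (hy : y ∈ freePart τ b) :
      Relator (x * y + superSign a b • (y * x))
  | jacobi {a b c : ZMod 2} {x y z : Free n H} (hx : x ∈ freePart τ a) (hy : y ∈ freePart τ b)
      (hz : z ∈ freePart τ c) :
      Relator (x * (y * z) - ((x * y) * z + superSign a b • (y * (x * z))))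
  | h_h (h h' : H) : Relator (freeH n h * freeH n h')
  | h_e (h : H) (i : Fin n) : Relator (freeH n h * freeE H i - R.root i h • freeE H i)
  | h_f (h : H) (i : Fin n) : Relator (freeH n h * freeF H i - (-R.root i h) • freeF H i)
  | e_f_same (i : Fin n) : Relator (freeE H i * freeF H i - freeH n (R.coroot i))
  | e_f_ne (i j : Fin n) (hij : i ≠ j) : Relator (freeE H i * freeF H j)

/-- The two-sided ideal of the free algebra generated by the relators. -/
def relationIdeal : Submodule ℂ (Free n H) :=
  sInf {S | (∀ x, Relator R τ x → x ∈ S) ∧ ∀ x ∈ S, ∀ y, y * x ∈ S ∧ x * y ∈ S}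

theorem relator_mem {x : Free n H} (hx : Relator R τ x) : x ∈ relationIdeal R τ :=
  Submodule.mem_sInf.2 fun _ hS => hS.1 x hx

theorem mul_mem_relationIdeal {x : Free n H} (hx : x ∈ relationIdeal R τ) (y : Free n H) :
    y * x ∈ relationIdeal R τ ∧ x * y ∈ relationIdeal R τ :=
  ⟨Submodule.mem_sInf.2 fun S hS => (hS.2 x (Submodule.mem_sInf.1 hx S hS) y).1,
    Submodule.mem_sInf.2 fun S hS => (hS.2 x (Submodule.mem_sInf.1 hx S hS) y).2⟩

theorem Relator.homogeneous {x : Free n H} (hx : Relator R τ x) : ∃ a, x ∈ freePart τ a := by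
  have hh : ∀ h : H, freeH n h ∈ freePart τ 0 := fun h => of_mem_freePart τ (.h h)
  have he : ∀ i : Fin n, freeE H i ∈ freePart τ (τ i) := fun i => of_mem_freePart τ (.e i)
  have hf : ∀ i : Fin n, freeF H i ∈ freePart τ (τ i) := fun i => of_mem_freePart τ (.f i)
  cases hx with
  | linear c h h' =>
    exact ⟨0, sub_mem (hh _) (add_mem (Submodule.smul_mem _ _ (hh _)) (hh _))⟩
  | @skew a b x y hx hy =>
    refine ⟨a + b, add_mem (mul_mem_freePart τ hx hy) (Submodule.smul_mem _ _ ?_)⟩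
    rw [add_comm]; exact mul_mem_freePart τ hy hx
  | @jacobi a b c x y z hx hy hz =>
    refine ⟨a + (b + c), sub_mem (mul_mem_freePart τ hx (mul_mem_freePart τ hy hz))
      (add_mem ?_ (Submodule.smul_mem _ _ ?_))⟩
    · rw [← add_assoc]; exact mul_mem_freePart τ (mul_mem_freePart τ hx hy) hz
    · rw [add_left_comm]; exact mul_mem_freePart τ hy (mul_mem_freePart τ hx hz)
  | h_h h h' => exact ⟨0 + 0, mul_mem_freePart τ (hh _) (hh _)⟩
  | h_e h i =>
    refine ⟨0 + τ i, sub_mem (mul_mem_freePart τ (hh _) (he _)) (Submodule.smul_mem _ _ ?_)⟩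
    rw [zero_add]; exact he i
  | h_f h i =>
    refine ⟨0 + τ i, sub_mem (mul_mem_freePart τ (hh _) (hf _)) (Submodule.smul_mem _ _ ?_)⟩
    rw [zero_add]; exact hf i
  | e_f_same i =>
    refine ⟨τ i + τ i, sub_mem (mul_mem_freePart τ (he _) (hf _)) ?_⟩
    have : ∀ a : ZMod 2, a + a = 0 := by decide
    rw [this]; exact hh _
  | e_f_ne i j _ => exact ⟨τ i + τ j, mul_mem_freePart τ (he _) (hf _)⟩

theorem relationIdeal_graded : relationIdeal R τ ≤
    (relationIdeal R τ ⊓ freePart τ 0) ⊔ (relationIdeal R τ ⊓ freePart τ 1) := by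
  have hle : ∀ a, relationIdeal R τ ⊓ freePart τ a ≤
      (relationIdeal R τ ⊓ freePart τ 0) ⊔ (relationIdeal R τ ⊓ freePart τ 1) := by
    have h01 : ∀ a : ZMod 2, a = 0 ∨ a = 1 := by decide
    intro a
    rcases h01 a with rfl | rfl
    · exact le_sup_left
    · exact le_sup_right
  refine sInf_le ⟨fun x hx => ?_, fun x hx y => ?_⟩
  · obtain ⟨a, ha⟩ := hx.homogeneous
    exact hle a ⟨relator_mem R τ hx, ha⟩
  · have hy : y ∈ freePart τ (H := H) 0 ⊔ freePart τ 1 := by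
      rw [(isCompl_freePart τ).sup_eq_top]; trivial
    obtain ⟨x0, hx0, x1, hx1, rfl⟩ := Submodule.mem_sup.1 hx
    obtain ⟨y0, hy0, y1, hy1, rfl⟩ := Submodule.mem_sup.1 hy
    have kl : ∀ a b : ZMod 2, ∀ u ∈ relationIdeal R τ ⊓ freePart τ a, ∀ v ∈ freePart τ b,
        v * u ∈ (relationIdeal R τ ⊓ freePart τ 0) ⊔ (relationIdeal R τ ⊓ freePart τ 1) :=
      fun a b u hu v hv =>
        hle _ ⟨(mul_mem_relationIdeal R τ hu.1 v).1, mul_mem_freePart τ hv hu.2⟩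
    have kr : ∀ a b : ZMod 2, ∀ u ∈ relationIdeal R τ ⊓ freePart τ a, ∀ v ∈ freePart τ b,
        u * v ∈ (relationIdeal R τ ⊓ freePart τ 0) ⊔ (relationIdeal R τ ⊓ freePart τ 1) :=
      fun a b u hu v hv =>
        hle _ ⟨(mul_mem_relationIdeal R τ hu.1 v).2, mul_mem_freePart τ hu.2 hv⟩
    simp only [mul_add, add_mul]
    exact ⟨add_mem (add_mem (kl _ _ _ hx0 _ hy0) (kl _ _ _ hx0 _ hy1))
        (add_mem (kl _ _ _ hx1 _ hy0) (kl _ _ _ hx1 _ hy1)),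
      add_mem (add_mem (kr _ _ _ hx0 _ hy0) (kr _ _ _ hx1 _ hy0))
        (add_mem (kr _ _ _ hx0 _ hy1) (kr _ _ _ hx1 _ hy1))⟩

/-- The Lie superalgebra `g̃(B, τ)`. -/
abbrev Tilde : Type _ := Free n H ⧸ relationIdeal R τ

/-- The bracket of `g̃(B, τ)`, induced by the product of the free algebra. -/
def tildeBracket : Tilde R τ →ₗ[ℂ] Tilde R τ →ₗ[ℂ] Tilde R τ :=
  quotientBracket (LinearMap.mul ℂ (Free n H)) (relationIdeal R τ)
    (fun x y hy => by
      rw [LinearMap.mul_apply']; exact (mul_mem_relationIdeal R τ hy x).1)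
    (fun x hx y => by
      rw [LinearMap.mul_apply']; exact (mul_mem_relationIdeal R τ hx y).2)

theorem tildeBracket_mk (x y : Free n H) :
    tildeBracket R τ ((relationIdeal R τ).mkQ x) ((relationIdeal R τ).mkQ y) =
      (relationIdeal R τ).mkQ (x * y) := rfl

instance : LieSuperalgebra (Tilde R τ) where
  part a := (freePart τ a).map (relationIdeal R τ).mkQ
  isCompl_part := isCompl_map_mkQ (isCompl_freePart τ) (relationIdeal_graded R τ)
  bracket := tildeBracket R τ
  bracket_mem := by
    rintro a b _ _ ⟨x, hx, rfl⟩ ⟨y, hy, rfl⟩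
    exact ⟨_, mul_mem_freePart τ hx hy, rfl⟩
  skew := by
    rintro a b _ _ ⟨x, hx, rfl⟩ ⟨y, hy, rfl⟩
    rw [tildeBracket_mk, tildeBracket_mk, ← map_smul, ← map_neg, ← sub_eq_zero, ← map_sub,
      Submodule.mkQ_apply, Submodule.Quotient.mk_eq_zero, sub_neg_eq_add]
    exact relator_mem R τ (.skew hx hy)
  jacobi := by
    rintro a b _ _ z ⟨x, hx, rfl⟩ ⟨y, hy, rfl⟩
    have key : ∀ c : ZMod 2, ∀ w ∈ freePart τ c, x * (y * w) -
        ((x * y) * w + superSign a b • (y * (x * w))) ∈ relationIdeal R τ :=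
      fun c w hw => relator_mem R τ (.jacobi hx hy hw)
    obtain ⟨z, rfl⟩ := (relationIdeal R τ).mkQ_surjective z
    have hz : z ∈ freePart τ (H := H) 0 ⊔ freePart τ 1 := by
      rw [(isCompl_freePart τ).sup_eq_top]; trivial
    obtain ⟨z0, hz0, z1, hz1, rfl⟩ := Submodule.mem_sup.1 hz
    simp only [tildeBracket_mk]
    rw [← map_smul, ← map_add, ← sub_eq_zero, ← map_sub,
      Submodule.mkQ_apply, Submodule.Quotient.mk_eq_zero]
    convert add_mem (key 0 z0 hz0) (key 1 z1 hz1) using 1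
    simp only [mul_add, smul_add]
    abel

/-- The canonical linear map from `H` to `g̃(B, τ)`. -/
def tildeCartan : H →ₗ[ℂ] Tilde R τ where
  toFun h := (relationIdeal R τ).mkQ (freeH n h)
  map_add' h h' := by
    rw [← map_add, ← sub_eq_zero, ← map_sub, Submodule.mkQ_apply, Submodule.Quotient.mk_eq_zero]
    simpa using relator_mem R τ (.linear 1 h h')
  map_smul' c h := by
    have h0 : freeH n (0 : H) ∈ relationIdeal R τ := by
      have := relator_mem R τ (.linear 1 (0 : H) 0)
      rw [smul_zero, add_zero, one_smul, sub_add_cancel_left] at this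
      exact neg_mem_iff.1 this
    rw [RingHom.id_apply, ← map_smul, ← sub_eq_zero, ← map_sub, Submodule.mkQ_apply,
      Submodule.Quotient.mk_eq_zero]
    have := add_mem (relator_mem R τ (.linear c h 0)) h0
    rw [add_zero] at this
    convert this using 1
    abel

/-- The maximal ideal `r` of `g̃(B, τ)` which intersects the Cartan subalgebra trivially, as the
sum of all graded ideals which do so. -/
def radical : Submodule ℂ (Tilde R τ) :=
  sSup {S | IsGradedIdeal S ∧ Disjoint S (LinearMap.range (tildeCartan R τ))}

theorem isGradedIdeal_radical : IsGradedIdeal (radical R τ) :=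
  isGradedIdeal_sSup fun _ hS => hS.1

end Contragredient

open Contragredient

/-! ## The contragredient Lie superalgebra `g(B, τ)` -/

section Contragredient

variable {n : ℕ} {B : Matrix (Fin n) (Fin n) ℂ} {H : Type*} [AddCommGroup H] [Module ℂ H]
  (R : MinimalRealization B H) (τ : Fin n → ZMod 2)

/-- The contragredient Lie superalgebra `g(B, τ)`, the quotient of `g̃(B, τ)` by `r`. -/
abbrev ContragredientLieSuperalgebra : Type _ := Tilde R τ ⧸ radical R τ

instance : LieSuperalgebra (ContragredientLieSuperalgebra R τ) :=
  LieSuperalgebra.quotient (radical R τ) (isGradedIdeal_radical R τ)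

namespace ContragredientLieSuperalgebra

/-- The canonical map from `H` to `g(B, τ)`; its range is the Cartan subalgebra. -/
def cartan : H →ₗ[ℂ] ContragredientLieSuperalgebra R τ :=
  (radical R τ).mkQ ∘ₗ tildeCartan R τ

/-- The root space of `α` (the weight space, for arbitrary `α` in the dual of `H`). -/
def rootSpace (α : Module.Dual ℂ H) : Submodule ℂ (ContragredientLieSuperalgebra R τ) where
  carrier := {x | ∀ h : H, bracket (cartan R τ h) x = α h • x}
  add_mem' := fun hx hy h => by rw [map_add, hx h, hy h, smul_add]
  zero_mem' := fun h => by rw [map_zero, smul_zero]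
  smul_mem' := fun c x hx h => by rw [map_smul, hx h, smul_comm]

/-- `α` is a root of `g(B, τ)`. -/
def IsRoot (α : Module.Dual ℂ H) : Prop := α ≠ 0 ∧ rootSpace R τ α ≠ ⊥

/-- The sequence `β` is an ordered root base of `g(B, τ)`, with Chevalley generators `e`, `f`. -/
structure IsChevalley (β : Fin n → Module.Dual ℂ H)
    (e f : Fin n → ContragredientLieSuperalgebra R τ) : Prop where
  linearIndependent : LinearIndependent ℂ β
  isRoot : ∀ i, IsRoot R τ (β i)
  e_mem : ∀ i, e i ∈ rootSpace R τ (β i)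
  f_mem : ∀ i, f i ∈ rootSpace R τ (-β i)
  generates : Generates (Set.range (cartan R τ) ∪ Set.range e ∪ Set.range f)
  bracket_e_f : ∀ i j, i ≠ j → bracket (e i) (f j) = 0

/-- The sequence `β` is an ordered root base of `g(B, τ)`. -/
def IsOrderedRootBase (β : Fin n → Module.Dual ℂ H) : Prop :=
  ∃ e f, IsChevalley R τ β e f

/-- `C` is the Cartan datum determined by the Chevalley generators `e`, `f` of the ordered root
base `β`: the parities of `e i` and `f i` are `C.τ i`, and `C.B i j = β j (h i)`, where `h i` is
the element of the Cartan subalgebra equal to `[e i, f i]`. -/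
structure HasCartanDatum (β : Fin n → Module.Dual ℂ H)
    (e f : Fin n → ContragredientLieSuperalgebra R τ) (C : CartanDatum n) : Prop where
  isChevalley : IsChevalley R τ β e f
  e_parity : ∀ i, e i ∈ part (L := ContragredientLieSuperalgebra R τ) (C.τ i)
  f_parity : ∀ i, f i ∈ part (L := ContragredientLieSuperalgebra R τ) (C.τ i)
  matrix_eq : ∃ h : Fin n → H, (∀ i, cartan R τ (h i) = bracket (e i) (f i)) ∧
    ∀ i j, C.B i j = β j (h i)

/-- `h` is a coroot of the simple root `β i` of the ordered root base `β` (it is unique up to a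
non-zero scalar). -/
def IsCoroot (β : Fin n → Module.Dual ℂ H) (i : Fin n) (h : H) : Prop :=
  ∃ e f, IsChevalley R τ β e f ∧ cartan R τ h = bracket (e i) (f i)

/-- The simple root `β i` is odd isotropic. -/
def IsOddIsotropic (β : Fin n → Module.Dual ℂ H) (i : Fin n) : Prop :=
  rootSpace R τ (β i) ≤ part (L := ContragredientLieSuperalgebra R τ) 1 ∧ ∃ h, IsCoroot R τ β i h ∧ β i h = 0

open Classical in
/-- `β'` is obtained from the ordered root base `β` by odd reflection at the odd isotropic simple
root `β i`. -/
def IsOddReflection (β : Fin n → Module.Dual ℂ H) (i : Fin n) (β' : Fin n → Module.Dual ℂ H) :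
    Prop :=
  IsOddIsotropic R τ β i ∧ ∃ h, IsCoroot R τ β i h ∧
    ∀ j, β' j = if j = i then -β i else if β j h = 0 then β j else β j + β i

end ContragredientLieSuperalgebra

end Contragredient

end

noncomputable section

/-! The reflected generators can be written down: `f i` and `-e i` at the index `i`, and `[e i, e
j]` with a multiple of `[f i, f j]` wherever `β j (h i) ≠ 0`. Symmetry of the matrix makes `[[e i, e
j], [f i, f j]]` a multiple of `h i + h j` (`bracket_ee_ff`), so the new coroots are `-h i`, `h j`
or `h i + h j`, and the new matrix comes from evaluating the new roots on them. Bracketing back with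
`f i` or `e i` recovers the old generators, so the new ones generate. The relations between
different indices also need `[e i, e k] = 0` when both Cartan entries vanish, in particular `[e i, e
i] = 0`; only here does the quotient by the maximal ideal enter.

Two structural facts support this, both proved for an abstract `IsChevalleySystem`, which covers
`g̃` and `g` alike. The triangular decomposition `sup_eq_top` writes the algebra as a sum of
negative part, Cartan part and positive part. Evaluating on an `h` where the simple roots take
chosen positive integer values, the eigenvalues of `ad h` separate these parts. First, ideals
avoiding the Cartan subalgebra have a sum that avoids it (`disjoint_sSup`); hence `g` has no nonzero
graded ideal of this kind, and a homogeneous positive weight vector killed by all `f j` is zero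
(`eq_zero_of_bracket_f`, `bracket_e_e`). Second, the weight space of a simple root is spanned by its
generator (`mem_span_of_weight`), so Chevalley generators are unique up to scalars and all Cartan
data of one base agree up to row scaling (`exists_weight_eq_mul`).

For a sequence of reflections, the generators are rescaled to make the matrix symmetric before each
step; the reflection formula preserves symmetry, and uniqueness transfers symmetrizability to every
choice of generators. -/

theorem superSign_zero_left (b : ZMod 2) : superSign 0 b = 1 := by simp [superSign]

theorem superSign_comm (a b : ZMod 2) : superSign a b = superSign b a := by
  rw [superSign, superSign, mul_comm]

theorem superSign_mul_self (a b : ZMod 2) : superSign a b * superSign a b = 1 := by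
  rw [superSign, ← mul_pow]; simp

theorem superSign_one_one : superSign 1 1 = -1 := by simp [superSign, ZMod.val_one]

/-- A linearly independent finite family of linear forms takes arbitrary prescribed values. -/
theorem exists_forall_dual_eq {n : ℕ} {H : Type*} [AddCommGroup H] [Module ℂ H]
    {β : Fin n → Module.Dual ℂ H} (hβ : LinearIndependent ℂ β) (w : Fin n → ℂ) :
    ∃ h, ∀ j, β j h = w j := by
  have hsurj : LinearMap.range (LinearMap.pi β) = ⊤ := by
    -- A functional vanishing on a proper range would be a linear relation among the `β j`.
    by_contra hne
    obtain ⟨φ, hφ, hle⟩ := Submodule.exists_le_ker_of_lt_top _ (lt_top_iff_ne_top.2 hne)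
    refine hφ (LinearMap.pi_ext' fun j => LinearMap.ext_ring ?_)
    have hrel : ∑ j, φ (Pi.single j 1) • β j = 0 := by
      ext h
      have h0 : φ (LinearMap.pi β h) = 0 := hle ⟨h, rfl⟩
      rw [LinearMap.zero_apply, ← h0, LinearMap.pi_apply_eq_sum_univ φ, LinearMap.sum_apply]
      refine Finset.sum_congr rfl fun j _ => ?_
      rw [LinearMap.smul_apply, LinearMap.pi_apply, smul_eq_mul, smul_eq_mul, mul_comm]
      congr 2
      ext k
      simp [Pi.single_apply, eq_comm]
    simpa using Fintype.linearIndependent_iff.1 hβ _ hrel j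
  obtain ⟨h, hh⟩ := (LinearMap.range_eq_top.1 hsurj) w
  exact ⟨h, fun j => congrFun hh j⟩

/-! ### Eigenspaces of one endomorphism -/

namespace Module.End

variable {V : Type*} [AddCommGroup V] [Module ℂ V]

theorem disjoint_eigenspace (T : Module.End ℂ V) (μ : ℂ) :
    Disjoint (T.eigenspace μ) (⨆ ν : ℂ, ⨆ _ : ν ≠ μ, T.eigenspace ν) :=
  T.eigenspaces_iSupIndep μ

/-- An eigenvector for `μ` is killed by `X - μ`, whose value at `0` is `-μ`; sums are killed by
products. -/
theorem exists_polynomial_aeval_eq_zero (T : End ℂ V) {y : V}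
    (hy : y ∈ ⨆ μ : ℂ, ⨆ _ : μ ≠ 0, T.eigenspace μ) :
    ∃ p : Polynomial ℂ, p.eval 0 ≠ 0 ∧ Polynomial.aeval T p y = 0 := by
  induction hy using Submodule.iSup_induction' with
  | mem μ x hx =>
    by_cases hμ : μ = 0
    · subst hμ
      -- The inner supremum is empty for `μ = 0`, so the vector is zero.
      refine ⟨1, by simp, ?_⟩
      simpa using hx
    · refine ⟨Polynomial.X - Polynomial.C μ, by simpa using hμ, ?_⟩
      have hx' : T x = μ • x := mem_eigenspace_iff.1 (by simpa [hμ] using hx)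
      simp [hx']
  | zero => exact ⟨1, by simp, by simp⟩
  | add x y _ _ hx hy =>
    obtain ⟨p, hp0, hp⟩ := hx
    obtain ⟨q, hq0, hq⟩ := hy
    refine ⟨q * p, by simp [hp0, hq0], ?_⟩
    rw [map_add, map_mul, Module.End.mul_apply, hp, map_zero, zero_add, ← map_mul, mul_comm q p,
      map_mul, Module.End.mul_apply, hq, map_zero]

theorem aeval_mem (T : End ℂ V) {S : Submodule ℂ V} (hS : ∀ x ∈ S, T x ∈ S)
    (p : Polynomial ℂ) {x : V} (hx : x ∈ S) : Polynomial.aeval T p x ∈ S := by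
  induction p using Polynomial.induction_on' with
  | add p q hp hq => simpa using S.add_mem hp hq
  | monomial k a =>
    rw [Polynomial.aeval_monomial, Module.End.mul_apply, Module.algebraMap_end_apply]
    refine S.smul_mem _ ?_
    clear a
    induction k with
    | zero => simpa using hx
    | succ k ih => rw [pow_succ', Module.End.mul_apply]; exact hS _ ih

/-- A `T`-stable subspace which meets `ker T` trivially lies in the sum of the other eigenspaces,
when `T` is diagonalizable. -/
theorem le_iSup_eigenspace_of_disjoint (T : End ℂ V) (hT : ⨆ μ, T.eigenspace μ = ⊤)
    {S : Submodule ℂ V} (hS : ∀ x ∈ S, T x ∈ S) (hdis : Disjoint S (T.eigenspace 0)) :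
    S ≤ ⨆ μ : ℂ, ⨆ _ : μ ≠ 0, T.eigenspace μ := by
  intro x hx
  have hsplit : x ∈ T.eigenspace 0 ⊔ ⨆ μ : ℂ, ⨆ _ : μ ≠ 0, T.eigenspace μ := by
    rw [← iSup_split_single, hT]; trivial
  obtain ⟨x₀, hx₀, y, hy, rfl⟩ := Submodule.mem_sup.1 hsplit
  -- Applying `p(T)` kills `y` and multiplies the kernel component `x₀` by `p(0) ≠ 0`; stability of
  -- `S` then puts `x₀` itself in `S`.
  obtain ⟨p, hp0, hp⟩ := exists_polynomial_aeval_eq_zero T hy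
  have hTx : T x₀ = 0 := by simpa using hx₀
  have hev : Polynomial.aeval T p x₀ = p.eval 0 • x₀ := by
    induction p using Polynomial.induction_on' with
    | add p q hp hq =>
      have key : ∀ p : Polynomial ℂ, Polynomial.aeval T p x₀ = p.eval 0 • x₀ := by
        intro p
        conv_lhs => rw [← Polynomial.divX_mul_X_add p]
        simp [hTx, Polynomial.coeff_zero_eq_eval_zero]
      exact key _
    | monomial k a =>
      cases k <;> simp [pow_succ, hTx, ← Polynomial.C_mul_X_pow_eq_monomial]
  have hmem := aeval_mem T hS p hx
  rw [map_add, hp, add_zero, hev] at hmem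
  have h0 : x₀ ∈ S := (S.smul_mem_iff hp0).1 hmem
  rw [Submodule.disjoint_def.1 hdis x₀ h0 hx₀, zero_add]
  exact hy

end Module.End

/-! ### Generating sets and subspaces stable under brackets -/

namespace LieSuperalgebra

variable {L : Type*} [AddCommGroup L] [Module ℂ L] [LieSuperalgebra L]

/-- A subspace stable under homogeneous generators is stable under the whole superalgebra. -/
theorem Generates.bracket_mem {s : Set L} (hs : Generates s)
    (hpart : ∀ x ∈ s, ∃ a, x ∈ part (L := L) a) {T : Submodule ℂ L}
    (hT : ∀ x ∈ s, ∀ y ∈ T, bracket x y ∈ T) (x : L) : ∀ y ∈ T, bracket x y ∈ T := by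
  -- The Jacobi identity is available for homogeneous elements only, so the stabilizer of `T` is
  -- taken in each parity separately; the sum of the two pieces is a subalgebra.
  let N : ZMod 2 → Submodule ℂ L := fun a =>
    { carrier := {x | x ∈ part a ∧ ∀ y ∈ T, bracket x y ∈ T}
      add_mem' := fun hx hy => ⟨add_mem hx.1 hy.1, fun t ht => by
        rw [map_add, LinearMap.add_apply]; exact add_mem (hx.2 t ht) (hy.2 t ht)⟩
      zero_mem' := ⟨zero_mem _, fun t _ => by simp⟩
      smul_mem' := fun r x hx => ⟨Submodule.smul_mem _ _ hx.1, fun t ht => by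
        rw [map_smul, LinearMap.smul_apply]; exact T.smul_mem _ (hx.2 t ht)⟩ }
  have hle : ∀ a, N a ≤ N 0 ⊔ N 1 := by
    have h01 : ∀ a : ZMod 2, a = 0 ∨ a = 1 := by decide
    intro a
    rcases h01 a with rfl | rfl
    · exact le_sup_left
    · exact le_sup_right
  have hN : ∀ a b, ∀ x ∈ N a, ∀ y ∈ N b, bracket x y ∈ N 0 ⊔ N 1 := by
    intro a b x hx y hy
    refine hle (a + b) ⟨LieSuperalgebra.bracket_mem hx.1 hy.1, fun t ht => ?_⟩
    rw [← add_sub_cancel_right (bracket (bracket x y) t)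
      (superSign a b • bracket y (bracket x t)), ← jacobi hx.1 hy.1]
    exact sub_mem (hx.2 _ (hy.2 t ht)) (T.smul_mem _ (hy.2 _ (hx.2 t ht)))
  have htop : N 0 ⊔ N 1 = ⊤ := by
    refine hs _ (fun x hx => ?_) fun x hx y hy => ?_
    · obtain ⟨a, ha⟩ := hpart x hx
      exact hle a ⟨ha, hT x hx⟩
    · obtain ⟨x0, hx0, x1, hx1, rfl⟩ := Submodule.mem_sup.1 hx
      obtain ⟨y0, hy0, y1, hy1, rfl⟩ := Submodule.mem_sup.1 hy
      simp only [map_add, LinearMap.add_apply]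
      exact add_mem (add_mem (hN _ _ _ hx0 _ hy0) (hN _ _ _ hx1 _ hy0))
        (add_mem (hN _ _ _ hx0 _ hy1) (hN _ _ _ hx1 _ hy1))
  obtain ⟨x0, hx0, x1, hx1, rfl⟩ := Submodule.mem_sup.1 (htop ▸ Submodule.mem_top : x ∈ N 0 ⊔ N 1)
  intro y hy
  rw [map_add, LinearMap.add_apply]
  exact add_mem (hx0.2 y hy) (hx1.2 y hy)

theorem bracket_even_skew {a : ZMod 2} {x y : L} (hx : x ∈ part (L := L) 0)
    (hy : y ∈ part (L := L) a) : bracket y x = -bracket x y := by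
  rw [skew hx hy, superSign_zero_left, one_smul, neg_neg]

theorem jacobi_even {a : ZMod 2} {x y : L} (z : L) (hx : x ∈ part (L := L) 0)
    (hy : y ∈ part (L := L) a) :
    bracket x (bracket y z) = bracket (bracket x y) z + bracket y (bracket x z) := by
  rw [jacobi hx hy, superSign_zero_left, one_smul]

/-- The smallest subspace containing `s` and stable under the brackets with the `x j`. -/
def orbitSpan {ι : Type*} (x : ι → L) (s : Set L) : Submodule ℂ L :=
  sInf {T | s ⊆ T ∧ ∀ j, ∀ y ∈ T, bracket (x j) y ∈ T}

section orbitSpan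

variable {ι : Type*} {x : ι → L} {s : Set L}

theorem subset_orbitSpan : s ⊆ orbitSpan x s := fun _ hy =>
  Submodule.mem_sInf.2 fun _ hT => hT.1 hy

theorem bracket_mem_orbitSpan (j : ι) {y : L} (hy : y ∈ orbitSpan x s) :
    bracket (x j) y ∈ orbitSpan x s :=
  Submodule.mem_sInf.2 fun T hT => hT.2 j y (Submodule.mem_sInf.1 hy T hT)

theorem orbitSpan_le {T : Submodule ℂ L} (h : s ⊆ T) (hT : ∀ j, ∀ y ∈ T, bracket (x j) y ∈ T) :
    orbitSpan x s ≤ T := sInf_le ⟨h, hT⟩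

/-- Brackets with an even element normalizing the lines through the `x j` and the elements of `s`
preserve `orbitSpan x s`. -/
theorem bracket_even_mem_orbitSpan {h : L} (hh : h ∈ part (L := L) 0) {τ : ι → ZMod 2}
    (hx : ∀ j, x j ∈ part (L := L) (τ j)) (hhx : ∀ j, ∃ r : ℂ, bracket h (x j) = r • x j)
    (hs : ∀ y ∈ s, ∃ r : ℂ, bracket h y = r • y) {y : L} (hy : y ∈ orbitSpan x s) :
    bracket h y ∈ orbitSpan x s := by
  -- Intersecting with the span itself keeps the membership of `y` available in the inductive step.
  have hle : orbitSpan x s ≤ orbitSpan x s ⊓ (orbitSpan x s).comap (bracket h) := by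
    refine orbitSpan_le (fun y hy => ⟨subset_orbitSpan hy, ?_⟩) fun j y hy =>
      ⟨bracket_mem_orbitSpan j hy.1, ?_⟩
    · obtain ⟨r, hr⟩ := hs y hy
      rw [Submodule.comap_coe, Set.mem_preimage, hr]
      exact Submodule.smul_mem _ _ (subset_orbitSpan hy)
    · obtain ⟨r, hr⟩ := hhx j
      change bracket h (bracket (x j) y) ∈ orbitSpan x s
      rw [jacobi_even _ hh (hx j), hr, map_smul, LinearMap.smul_apply]
      exact add_mem (Submodule.smul_mem _ _ (bracket_mem_orbitSpan j hy.1))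
        (bracket_mem_orbitSpan j hy.2)
  exact (hle hy).2

end orbitSpan

theorem bracket_bracket {a b : ZMod 2} {x y : L} (hx : x ∈ part (L := L) a)
    (hy : y ∈ part (L := L) b) (z : L) :
    bracket (bracket x y) z =
      bracket x (bracket y z) - superSign a b • bracket y (bracket x z) := by
  rw [jacobi hx hy, add_sub_cancel_right]

omit [LieSuperalgebra L] in
theorem eq_zero_of_eq_neg {x : L} (hx : x = -x) : x = 0 := by
  have h2 : (2 : ℂ) • x = 0 := by
    rw [two_smul]
    nth_rewrite 1 [hx]
    exact neg_add_cancel x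
  exact (smul_eq_zero.1 h2).resolve_left two_ne_zero

/-! ### Chevalley systems and eigenvalue filtrations -/

variable {n : ℕ} {H : Type*} [AddCommGroup H] [Module ℂ H]

/-- Homogeneous Chevalley generators relative to a commutative even subalgebra, the image
of `c`. -/
structure IsChevalleySystem (c : H →ₗ[ℂ] L) (β : Fin n → Module.Dual ℂ H) (e f : Fin n → L)
    (τ : Fin n → ZMod 2) : Prop where
  cartan_mem : ∀ h, c h ∈ part (L := L) 0
  cartan_cartan : ∀ h h', bracket (c h) (c h') = 0
  cartan_e : ∀ h j, bracket (c h) (e j) = β j h • e j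
  cartan_f : ∀ h j, bracket (c h) (f j) = (-β j) h • f j
  e_mem : ∀ j, e j ∈ part (L := L) (τ j)
  f_mem : ∀ j, f j ∈ part (L := L) (τ j)
  e_f_same : ∀ j, ∃ h, c h = bracket (e j) (f j)
  e_f_ne : ∀ j k, j ≠ k → bracket (e j) (f k) = 0
  generates : Generates (Set.range c ∪ Set.range e ∪ Set.range f)
  linearIndependent : LinearIndependent ℂ β

/-- The sum of the eigenspaces of `ad h` for the natural eigenvalues at least `k`. -/
def eigenFiltration (h : L) (k : ℕ) : Submodule ℂ L :=
  ⨆ (m : ℕ) (_ : k ≤ m), Module.End.eigenspace (bracket h) (m : ℂ)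

theorem eigenspace_le_eigenFiltration (h : L) {k m : ℕ} (hkm : k ≤ m) :
    Module.End.eigenspace (bracket h) (m : ℂ) ≤ eigenFiltration h k :=
  le_iSup₂_of_le m hkm le_rfl

theorem eigenFiltration_anti (h : L) {k l : ℕ} (hkl : k ≤ l) :
    eigenFiltration h l ≤ eigenFiltration h k :=
  iSup₂_le fun _ hm => eigenspace_le_eigenFiltration h (hkl.trans hm)

theorem bracket_mem_eigenspace {h x y : L} {a : ZMod 2} {μ ν : ℂ} (hh : h ∈ part (L := L) 0)
    (hx : x ∈ part (L := L) a) (hxμ : bracket h x = μ • x)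
    (hy : y ∈ Module.End.eigenspace (bracket h) ν) :
    bracket x y ∈ Module.End.eigenspace (bracket h) (μ + ν) := by
  rw [Module.End.mem_eigenspace_iff] at hy ⊢
  rw [jacobi_even _ hh hx, hxμ, hy, map_smul, map_smul, LinearMap.smul_apply, add_smul]

theorem bracket_mem_eigenFiltration {h x y : L} {a : ZMod 2} {w k : ℕ}
    (hh : h ∈ part (L := L) 0) (hx : x ∈ part (L := L) a) (hxw : bracket h x = (w : ℂ) • x)
    (hy : y ∈ eigenFiltration h k) : bracket x y ∈ eigenFiltration h (w + k) := by
  have hle : eigenFiltration h k ≤ (eigenFiltration h (w + k)).comap (bracket x) := by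
    refine iSup₂_le fun m hm z hz => ?_
    refine eigenspace_le_eigenFiltration h (Nat.add_le_add_left hm w) ?_
    rw [Nat.cast_add]
    exact bracket_mem_eigenspace hh hx hxw hz
  exact hle hy

namespace IsChevalleySystem

variable {c : H →ₗ[ℂ] L} {β : Fin n → Module.Dual ℂ H} {e f : Fin n → L} {τ : Fin n → ZMod 2}

/-- The axioms are invariant under exchanging raising and lowering operators, so each result on the
positive part also serves the negative part. The coroots change by `-superSign (τ j) (τ j)`, which
is `+1` in the odd case. -/
theorem symm (D : IsChevalleySystem c β e f τ) : IsChevalleySystem c (-β) f e τ where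
  cartan_mem := D.cartan_mem
  cartan_cartan := D.cartan_cartan
  cartan_e := D.cartan_f
  cartan_f h j := by rw [Pi.neg_apply, neg_neg]; exact D.cartan_e h j
  e_mem := D.f_mem
  f_mem := D.e_mem
  e_f_same j := by
    obtain ⟨h, hh⟩ := D.e_f_same j
    exact ⟨-(superSign (τ j) (τ j) • h), by
      rw [skew (D.f_mem j) (D.e_mem j), map_neg, map_smul, hh]⟩
  e_f_ne j k hjk := by
    rw [skew (D.f_mem j) (D.e_mem k), D.e_f_ne k j hjk.symm, smul_zero, neg_zero]
  generates := by
    have := D.generates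
    rwa [Set.union_right_comm] at this
  linearIndependent := by
    have := D.linearIndependent.units_smul (fun _ => (-1 : ℂˣ))
    convert this using 1
    ext j : 1
    simp

theorem homogeneous (D : IsChevalleySystem c β e f τ) :
    ∀ x ∈ Set.range c ∪ Set.range e ∪ Set.range f, ∃ a, x ∈ part (L := L) a := by
  rintro _ ((⟨h, rfl⟩ | ⟨j, rfl⟩) | ⟨j, rfl⟩)
  exacts [⟨_, D.cartan_mem h⟩, ⟨_, D.e_mem j⟩, ⟨_, D.f_mem j⟩]

theorem stable (D : IsChevalleySystem c β e f τ) {T : Submodule ℂ L}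
    (hc : ∀ h, ∀ y ∈ T, bracket (c h) y ∈ T) (he : ∀ j, ∀ y ∈ T, bracket (e j) y ∈ T)
    (hf : ∀ j, ∀ y ∈ T, bracket (f j) y ∈ T) (x : L) : ∀ y ∈ T, bracket x y ∈ T := by
  refine D.generates.bracket_mem D.homogeneous ?_ x
  rintro _ ((⟨h, rfl⟩ | ⟨j, rfl⟩) | ⟨j, rfl⟩)
  exacts [hc h, he j, hf j]

theorem e_cartan (D : IsChevalleySystem c β e f τ) (h : H) (j : Fin n) :
    bracket (e j) (c h) = -(β j h • e j) := by
  rw [bracket_even_skew (D.cartan_mem h) (D.e_mem j), D.cartan_e]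

theorem f_cartan (D : IsChevalleySystem c β e f τ) (h : H) (j : Fin n) :
    bracket (f j) (c h) = β j h • f j := by
  rw [D.symm.e_cartan]; simp

/-! ### Triangular decomposition -/

theorem cartan_mem_orbitSpan (D : IsChevalleySystem c β e f τ) (h : H) {y : L}
    (hy : y ∈ orbitSpan e (Set.range e)) : bracket (c h) y ∈ orbitSpan e (Set.range e) := by
  refine bracket_even_mem_orbitSpan (D.cartan_mem h) D.e_mem (fun j => ⟨_, D.cartan_e h j⟩) ?_ hy
  rintro _ ⟨j, rfl⟩
  exact ⟨_, D.cartan_e h j⟩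

/-- Moving `f k` past `e j` leaves `[f k, e j]`, which is zero or a Cartan element, and Cartan
elements preserve the positive part. The Cartan summand is needed for the word `e k` alone. -/
theorem f_mem_orbitSpan_sup (D : IsChevalleySystem c β e f τ) (k : Fin n) {y : L}
    (hy : y ∈ orbitSpan e (Set.range e)) :
    bracket (f k) y ∈ orbitSpan e (Set.range e) ⊔ LinearMap.range c := by
  have hfe : ∀ j, ∃ h, bracket (f k) (e j) = c h := by
    intro j
    by_cases hkj : k = j
    · subst hkj
      obtain ⟨h, hh⟩ := D.symm.e_f_same k
      exact ⟨h, hh.symm⟩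
    · exact ⟨0, by rw [D.symm.e_f_ne k j hkj, map_zero]⟩
  have hle : orbitSpan e (Set.range e) ≤ orbitSpan e (Set.range e) ⊓
      (orbitSpan e (Set.range e) ⊔ LinearMap.range c).comap (bracket (f k)) := by
    refine orbitSpan_le ?_ fun j y hy => ⟨bracket_mem_orbitSpan j hy.1, ?_⟩
    · rintro _ ⟨j, rfl⟩
      obtain ⟨h, hh⟩ := hfe j
      refine ⟨subset_orbitSpan ⟨j, rfl⟩, ?_⟩
      change bracket (f k) (e j) ∈ orbitSpan e (Set.range e) ⊔ LinearMap.range c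
      rw [hh]
      exact Submodule.mem_sup_right ⟨h, rfl⟩
    · change bracket (f k) (bracket (e j) y) ∈ orbitSpan e (Set.range e) ⊔ LinearMap.range c
      obtain ⟨h, hh⟩ := hfe j
      rw [jacobi (D.f_mem k) (D.e_mem j), hh]
      refine add_mem (Submodule.mem_sup_left (D.cartan_mem_orbitSpan h hy.1))
        (Submodule.smul_mem _ _ ?_)
      -- By induction `[f k, y]` is `u` plus a Cartan element; `ad (e j)` turns the latter into a
      -- multiple of `e j`.
      obtain ⟨u, hu, _, ⟨h', rfl⟩, huv⟩ := Submodule.mem_sup.1 hy.2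
      rw [← huv, map_add, D.e_cartan]
      exact Submodule.mem_sup_left (add_mem (bracket_mem_orbitSpan j hu)
        (neg_mem (Submodule.smul_mem _ _ (subset_orbitSpan ⟨j, rfl⟩))))
  exact (hle hy).2

/-- The triangular decomposition. -/
theorem sup_eq_top (D : IsChevalleySystem c β e f τ) :
    orbitSpan f (Set.range f) ⊔ LinearMap.range c ⊔ orbitSpan e (Set.range e) = ⊤ := by
  set P := orbitSpan e (Set.range e)
  set M := orbitSpan f (Set.range f)
  set T := M ⊔ LinearMap.range c ⊔ P with hT
  have hP : P ≤ T := le_sup_right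
  have hM : M ≤ T := le_sup_left.trans le_sup_left
  have hC : LinearMap.range c ≤ T := le_sup_right.trans le_sup_left
  have split : ∀ x : L, (∀ y ∈ P, bracket x y ∈ T) → (∀ h, bracket x (c h) ∈ T) →
      (∀ y ∈ M, bracket x y ∈ T) → ∀ y ∈ T, bracket x y ∈ T := by
    intro x h1 h2 h3 y hy
    have hle : T ≤ T.comap (bracket x) := by
      refine sup_le (sup_le h3 ?_) h1
      rintro _ ⟨h, rfl⟩
      exact h2 h
    exact hle hy
  have heM : ∀ j, e j ∈ P := fun j => subset_orbitSpan ⟨j, rfl⟩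
  have hfM : ∀ j, f j ∈ M := fun j => subset_orbitSpan ⟨j, rfl⟩
  -- Stability under the generators gives stability under all of `L`, so `T` is a subalgebra; it
  -- contains the generators.
  have hst := D.stable (T := T)
    (fun h => split _ (fun y hy => hP (D.cartan_mem_orbitSpan h hy))
      (fun h' => by rw [D.cartan_cartan]; exact zero_mem _)
      (fun y hy => hM (D.symm.cartan_mem_orbitSpan h hy)))
    (fun j => split _ (fun y hy => hP (bracket_mem_orbitSpan j hy))
      (fun h => by
        rw [D.e_cartan]; exact neg_mem (Submodule.smul_mem _ _ (hP (heM j))))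
      (fun y hy => (sup_le hM hC) (D.symm.f_mem_orbitSpan_sup j hy)))
    (fun j => split _ (fun y hy => (sup_le hP hC) (D.f_mem_orbitSpan_sup j hy))
      (fun h => by
        rw [D.f_cartan]; exact Submodule.smul_mem _ _ (hM (hfM j)))
      (fun y hy => hM (bracket_mem_orbitSpan j hy)))
  refine D.generates T ?_ fun x _ y hy => hst x y hy
  rintro _ ((⟨h, rfl⟩ | ⟨j, rfl⟩) | ⟨j, rfl⟩)
  exacts [hC ⟨h, rfl⟩, hP (heM j), hM (hfM j)]

/-! ### Separating the parts by eigenvalues -/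

theorem orbitSpan_le_eigenFiltration (D : IsChevalleySystem c β e f τ) {h : H} {w : Fin n → ℕ}
    (hw : ∀ j, β j h = w j) (hpos : ∀ j, 1 ≤ w j) :
    orbitSpan e (Set.range e) ≤ eigenFiltration (c h) 1 := by
  refine orbitSpan_le ?_ fun j y hy => ?_
  · rintro _ ⟨j, rfl⟩
    refine eigenspace_le_eigenFiltration _ (hpos j) ?_
    rw [Module.End.mem_eigenspace_iff, D.cartan_e, hw]
  · exact eigenFiltration_anti _ (Nat.le_add_left _ _) (bracket_mem_eigenFiltration
      (D.cartan_mem h) (D.e_mem j) (by rw [D.cartan_e, hw]) hy)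

/-- With weight `1` at `i` and `2` elsewhere, every other generator has weight `2`, and any bracket
of generators has weight at least `1 + 1`. Hence only `e i` contributes to weight `1`. -/
theorem orbitSpan_le_span_sup (D : IsChevalleySystem c β e f τ) {h : H} {i : Fin n}
    (hi : β i h = 1) (hj : ∀ j, j ≠ i → β j h = 2) :
    orbitSpan e (Set.range e) ≤ Submodule.span ℂ {e i} ⊔ eigenFiltration (c h) 2 := by
  have hw : ∀ j, ∃ w : ℕ, 1 ≤ w ∧ β j h = w ∧ (j ≠ i → 2 ≤ w) := by
    intro j
    by_cases hji : j = i
    · exact ⟨1, le_rfl, by rw [hji, hi]; simp, fun h => absurd hji h⟩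
    · exact ⟨2, by norm_num, by rw [hj j hji]; simp, fun _ => le_rfl⟩
  have hei : e i ∈ eigenFiltration (c h) 1 := by
    refine eigenspace_le_eigenFiltration _ le_rfl ?_
    rw [Module.End.mem_eigenspace_iff, D.cartan_e, hi, Nat.cast_one]
  refine orbitSpan_le ?_ fun j y hy => ?_
  · rintro _ ⟨j, rfl⟩
    by_cases hji : j = i
    · subst hji
      exact Submodule.mem_sup_left (Submodule.mem_span_singleton_self _)
    · obtain ⟨w, -, hw, h2⟩ := hw j
      refine Submodule.mem_sup_right (eigenspace_le_eigenFiltration _ (h2 hji) ?_)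
      rw [Module.End.mem_eigenspace_iff, D.cartan_e, hw]
  · obtain ⟨w, h1, hw, -⟩ := hw j
    have hy1 : y ∈ eigenFiltration (c h) 1 :=
      sup_le ((Submodule.span_singleton_le_iff_mem _ _).2 hei)
        (eigenFiltration_anti _ one_le_two) hy
    exact Submodule.mem_sup_right (eigenFiltration_anti _ (Nat.add_le_add_right h1 1)
      (bracket_mem_eigenFiltration (D.cartan_mem h) (D.e_mem j) (by rw [D.cartan_e, hw]) hy1))

theorem eigenFiltration_le (x : L) {k : ℕ} {μ : ℂ} (hμ : ∀ m : ℕ, k ≤ m → (m : ℂ) ≠ μ) :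
    eigenFiltration x k ≤ ⨆ ν : ℂ, ⨆ _ : ν ≠ μ, Module.End.eigenspace (bracket x) ν :=
  iSup₂_le fun m hm => le_iSup₂_of_le (m : ℂ) (hμ m hm) le_rfl

theorem eigenFiltration_neg_le (x : L) {k : ℕ} {μ : ℂ} (hμ : ∀ m : ℕ, k ≤ m → -(m : ℂ) ≠ μ) :
    eigenFiltration (-x) k ≤ ⨆ ν : ℂ, ⨆ _ : ν ≠ μ, Module.End.eigenspace (bracket x) ν := by
  refine iSup₂_le fun m hm => le_iSup₂_of_le (-(m : ℂ)) (hμ m hm) fun y hy => ?_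
  rw [Module.End.mem_eigenspace_iff, map_neg, LinearMap.neg_apply] at hy
  rw [Module.End.mem_eigenspace_iff, neg_smul, ← hy, neg_neg]

theorem symm_orbitSpan_le (D : IsChevalleySystem c β e f τ) {h : H} {w : Fin n → ℕ}
    (hw : ∀ j, β j h = w j) (hpos : ∀ j, 1 ≤ w j) :
    orbitSpan f (Set.range f) ≤ eigenFiltration (-(c h)) 1 := by
  rw [← map_neg]
  exact D.symm.orbitSpan_le_eigenFiltration (w := w) (fun j => by simp [hw]) hpos

theorem cartan_le_eigenspace (D : IsChevalleySystem c β e f τ) (h : H) :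
    LinearMap.range c ≤ Module.End.eigenspace (bracket (c h)) 0 := by
  rintro _ ⟨h', rfl⟩
  rw [Module.End.mem_eigenspace_iff, D.cartan_cartan, zero_smul]

/-- The weight space of a simple root is spanned by the Chevalley generator. -/
theorem mem_span_of_weight (D : IsChevalleySystem c β e f τ) {i : Fin n} {x : L}
    (hx : ∀ h, bracket (c h) x = β i h • x) : x ∈ Submodule.span ℂ {e i} := by
  classical
  -- For this `h` the eigenvalue `1` of `ad h` isolates `e i`: the negative part has negative
  -- eigenvalues, the Cartan part `0`, and the rest of the positive part at least `2`.
  obtain ⟨h, hw⟩ := exists_forall_dual_eq D.linearIndependent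
    (fun j => ((if j = i then 1 else 2 : ℕ) : ℂ))
  have hi : β i h = 1 := by simp [hw]
  have hM := D.symm_orbitSpan_le hw (fun j => by split_ifs <;> norm_num)
  have hP := D.orbitSpan_le_span_sup hi (fun j hj => by simp [hw, hj])
  have hx' : x ∈ Submodule.span ℂ {e i} ⊔
      ⨆ ν : ℂ, ⨆ _ : ν ≠ 1, Module.End.eigenspace (bracket (c h)) ν := by
    have htop : x ∈ (⊤ : Submodule ℂ L) := trivial
    rw [← D.sup_eq_top] at htop
    refine sup_le (sup_le (le_sup_of_le_right (hM.trans (eigenFiltration_neg_le _ ?_)))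
      (le_sup_of_le_right ((D.cartan_le_eigenspace h).trans (le_iSup₂_of_le 0 zero_ne_one le_rfl))))
      (hP.trans (sup_le_sup_left (eigenFiltration_le _ ?_) _)) htop
    · intro m _ hm
      have : ((m : ℤ) : ℂ) = ((-1 : ℤ) : ℂ) := by push_cast; linear_combination -hm
      have := Int.cast_injective this
      omega
    · intro m hm h1
      have := Nat.cast_eq_one.1 h1
      omega
  obtain ⟨u, hu, y, hy, huy⟩ := Submodule.mem_sup.1 hx'
  obtain ⟨r, rfl⟩ := Submodule.mem_span_singleton.1 hu
  -- The remainder `x - r • e i` has eigenvalue `1` but lies in the sum of the other eigenspaces.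
  have hy1 : y ∈ Module.End.eigenspace (bracket (c h)) 1 := by
    have : y = x - r • e i := by rw [← huy]; abel
    rw [this, Module.End.mem_eigenspace_iff, map_sub, hx, map_smul, D.cartan_e, hi, one_smul,
      one_smul, one_smul]
  rw [← huy, Submodule.disjoint_def.1 (Module.End.disjoint_eigenspace _ 1) y hy1 hy, add_zero]
  exact hu

/-! ### Ideals that avoid the Cartan subalgebra -/

/-- Such an `h` grades the algebra by height, and the zero eigenspace of `ad h` is exactly the
Cartan part. -/
theorem exists_height (D : IsChevalleySystem c β e f τ) : ∃ h, ∀ j, β j h = (1 : ℕ) :=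
  exists_forall_dual_eq D.linearIndependent fun _ => ((1 : ℕ) : ℂ)

theorem range_sup_eq_top (D : IsChevalleySystem c β e f τ) {h : H} (hh : ∀ j, β j h = (1 : ℕ)) :
    LinearMap.range c ⊔ ⨆ ν : ℂ, ⨆ _ : ν ≠ 0, Module.End.eigenspace (bracket (c h)) ν = ⊤ := by
  rw [eq_top_iff, ← D.sup_eq_top]
  have hne : ∀ m : ℕ, 1 ≤ m → (m : ℂ) ≠ 0 := fun m hm => Nat.cast_ne_zero.2 (by omega)
  refine sup_le (sup_le (le_sup_of_le_right ?_) le_sup_left) (le_sup_of_le_right ?_)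
  · exact (D.symm_orbitSpan_le (w := fun _ => 1) hh (fun _ => le_rfl)).trans
      (eigenFiltration_neg_le _ fun m hm => neg_ne_zero.2 (hne m hm))
  · exact (D.orbitSpan_le_eigenFiltration (w := fun _ => 1) hh (fun _ => le_rfl)).trans
      (eigenFiltration_le _ hne)

theorem eigenspace_zero_le (D : IsChevalleySystem c β e f τ) {h : H}
    (hh : ∀ j, β j h = (1 : ℕ)) :
    Module.End.eigenspace (bracket (c h)) 0 ≤ LinearMap.range c := by
  intro x hx
  have htop : x ∈ (⊤ : Submodule ℂ L) := trivial
  rw [← D.range_sup_eq_top hh] at htop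
  obtain ⟨u, hu, y, hy, rfl⟩ := Submodule.mem_sup.1 htop
  have hy0 : y ∈ Module.End.eigenspace (bracket (c h)) 0 := by
    have := sub_mem hx (D.cartan_le_eigenspace h hu)
    rwa [add_sub_cancel_left] at this
  rw [Submodule.disjoint_def.1 (Module.End.disjoint_eigenspace _ 0) y hy0 hy, add_zero]
  exact hu

/-- The sum of all graded ideals which meet the Cartan subalgebra trivially does so as well. -/
theorem disjoint_sSup (D : IsChevalleySystem c β e f τ) :
    Disjoint (sSup {S | IsGradedIdeal S ∧ Disjoint S (LinearMap.range c)})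
      (LinearMap.range c) := by
  obtain ⟨h, hh⟩ := D.exists_height
  -- Each such ideal lies in the sum of the eigenspaces of nonzero height. This bound does not
  -- depend on the ideal, so it passes to the supremum.
  refine ((Module.End.disjoint_eigenspace (bracket (c h)) 0).symm).mono (sSup_le ?_)
    (D.cartan_le_eigenspace h)
  rintro S ⟨hS, hdis⟩
  refine Module.End.le_iSup_eigenspace_of_disjoint _ ?_ (fun x hx => hS.bracket_mem _ x hx)
    (hdis.mono_right (D.eigenspace_zero_le hh))
  rw [eq_top_iff, ← D.range_sup_eq_top hh]
  exact sup_le ((D.cartan_le_eigenspace h).trans (le_iSup _ 0)) (iSup₂_le fun ν _ => le_iSup _ ν)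

/-- In the absence of graded ideals meeting the Cartan subalgebra trivially, a homogeneous weight
vector of the positive part which is annihilated by all lowering operators vanishes. -/
theorem eq_zero_of_bracket_f (D : IsChevalleySystem c β e f τ)
    (hsimple : ∀ S : Submodule ℂ L, IsGradedIdeal S → Disjoint S (LinearMap.range c) → S = ⊥)
    {x : L} {a : ZMod 2} (ha : x ∈ part (L := L) a) {μ : Module.Dual ℂ H}
    (hμ : ∀ h, bracket (c h) x = μ h • x) (hx : x ∈ orbitSpan e (Set.range e))
    (hf : ∀ j, bracket (f j) x = 0) : x = 0 := by
  have hc : ∀ h, ∀ y ∈ orbitSpan e {x}, bracket (c h) y ∈ orbitSpan e {x} := fun h y hy =>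
    bracket_even_mem_orbitSpan (D.cartan_mem h) D.e_mem (fun j => ⟨_, D.cartan_e h j⟩)
      (by rintro _ rfl; exact ⟨_, hμ h⟩) hy
  -- Lowering operators can be moved through the `e j` until they reach `x`, where they vanish; so
  -- the raising orbit of `x` is already an ideal.
  have hideal : IsGradedIdeal (orbitSpan e {x}) := by
    constructor
    · refine D.stable hc (fun j y hy => bracket_mem_orbitSpan j hy) fun k => ?_
      have hle : orbitSpan e {x} ≤ orbitSpan e {x} ⊓ (orbitSpan e {x}).comap (bracket (f k)) := by
        refine orbitSpan_le ?_ fun j y hy => ⟨bracket_mem_orbitSpan j hy.1, ?_⟩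
        · rintro _ rfl
          refine ⟨subset_orbitSpan rfl, ?_⟩
          rw [Submodule.comap_coe, Set.mem_preimage, hf]
          exact zero_mem _
        · change bracket (f k) (bracket (e j) y) ∈ orbitSpan e {x}
          rw [jacobi (D.f_mem k) (D.e_mem j)]
          refine add_mem ?_ (Submodule.smul_mem _ _ (bracket_mem_orbitSpan j hy.2))
          by_cases hkj : k = j
          · subst hkj
            obtain ⟨h, hh⟩ := D.symm.e_f_same k
            rw [← hh]
            exact hc h y hy.1
          · rw [D.symm.e_f_ne k j hkj, map_zero, LinearMap.zero_apply]
            exact zero_mem _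
      exact fun y hy => (hle hy).2
    · have hle : ∀ b, orbitSpan e {x} ⊓ part b ≤
          (orbitSpan e {x} ⊓ part 0) ⊔ (orbitSpan e {x} ⊓ part 1) := by
        have h01 : ∀ a : ZMod 2, a = 0 ∨ a = 1 := by decide
        intro b
        rcases h01 b with rfl | rfl
        · exact le_sup_left
        · exact le_sup_right
      have hstep : ∀ j b, ∀ y ∈ orbitSpan e {x} ⊓ part b, bracket (e j) y ∈
          (orbitSpan e {x} ⊓ part 0) ⊔ (orbitSpan e {x} ⊓ part 1) := fun j b y hy =>
        hle _ ⟨bracket_mem_orbitSpan j hy.1, LieSuperalgebra.bracket_mem (D.e_mem j) hy.2⟩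
      refine orbitSpan_le ?_ fun j y hy => ?_
      · rintro _ rfl
        exact hle a ⟨subset_orbitSpan rfl, ha⟩
      · obtain ⟨y0, hy0, y1, hy1, rfl⟩ := Submodule.mem_sup.1 hy
        rw [map_add]
        exact add_mem (hstep j 0 y0 hy0) (hstep j 1 y1 hy1)
  -- The orbit has positive height, the Cartan part height `0`.
  have hdis : Disjoint (orbitSpan e {x}) (LinearMap.range c) := by
    obtain ⟨h, hh⟩ := D.exists_height
    have hle : orbitSpan e {x} ≤ orbitSpan e (Set.range e) :=
      orbitSpan_le (by rintro _ rfl; exact hx) fun j y hy => bracket_mem_orbitSpan j hy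
    refine ((Module.End.disjoint_eigenspace (bracket (c h)) 0).symm).mono (hle.trans ?_)
      (D.cartan_le_eigenspace h)
    exact (D.orbitSpan_le_eigenFiltration (w := fun _ => 1) hh (fun _ => le_rfl)).trans
      (eigenFiltration_le _ fun m hm => Nat.cast_ne_zero.2 (by omega))
  have : x ∈ orbitSpan e {x} := subset_orbitSpan rfl
  rwa [hsimple _ hideal hdis, Submodule.mem_bot] at this

theorem bracket_weight (D : IsChevalleySystem c β e f τ) {x y : L} {a : ZMod 2}
    {μ ν : Module.Dual ℂ H} (ha : x ∈ part (L := L) a) (hx : ∀ h, bracket (c h) x = μ h • x)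
    (hy : ∀ h, bracket (c h) y = ν h • y) (h : H) :
    bracket (c h) (bracket x y) = (μ + ν) h • bracket x y := by
  rw [jacobi_even _ (D.cartan_mem h) ha, hx, hy, map_smul, map_smul, LinearMap.smul_apply,
    LinearMap.add_apply, add_smul]

/-- Simple root vectors commute when the corresponding off-diagonal Cartan matrix entries
vanish. -/
theorem bracket_e_e (D : IsChevalleySystem c β e f τ)
    (hsimple : ∀ S : Submodule ℂ L, IsGradedIdeal S → Disjoint S (LinearMap.range c) → S = ⊥)
    {i k : Fin n} {hi hk : H} (hhi : c hi = bracket (e i) (f i)) (hhk : c hk = bracket (e k) (f k))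
    (hik : β k hi = 0) (hki : β i hk = 0) : bracket (e i) (e k) = 0 := by
  have hfe : ∀ j l, bracket (f l) (e j) = -(superSign (τ l) (τ j) • bracket (e j) (f l)) :=
    fun j l => skew (D.f_mem l) (D.e_mem j)
  -- In `[f l, [e i, e k]]` the two Jacobi terms are multiples of `β k hi` and `β i hk`. The case `i
  -- = k` is allowed; for an isotropic root it gives `[e i, e i] = 0`.
  refine D.eq_zero_of_bracket_f hsimple (LieSuperalgebra.bracket_mem (D.e_mem i) (D.e_mem k))
    (D.bracket_weight (D.e_mem i) (fun h => D.cartan_e h i) fun h => D.cartan_e h k)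
    (bracket_mem_orbitSpan i (subset_orbitSpan ⟨k, rfl⟩)) fun l => ?_
  have h1 : bracket (bracket (f l) (e i)) (e k) = 0 := by
    by_cases hl : i = l
    · subst hl
      rw [hfe, ← hhi, map_neg, map_smul, LinearMap.neg_apply, LinearMap.smul_apply, D.cartan_e,
        hik, zero_smul, smul_zero, neg_zero]
    · rw [hfe, D.e_f_ne i l hl]; simp
  have h2 : bracket (e i) (bracket (f l) (e k)) = 0 := by
    by_cases hl : k = l
    · subst hl
      rw [hfe, ← hhk, map_neg, map_smul, D.e_cartan, hki, zero_smul, neg_zero, smul_zero, neg_zero]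
    · rw [hfe, D.e_f_ne k l hl]; simp
  rw [jacobi (D.f_mem l) (D.e_mem i), h1, h2, smul_zero, add_zero]

/-- If `f i` vanished, all lowering operators would kill `e i`. -/
theorem f_ne_zero (D : IsChevalleySystem c β e f τ)
    (hsimple : ∀ S : Submodule ℂ L, IsGradedIdeal S → Disjoint S (LinearMap.range c) → S = ⊥)
    {i : Fin n} (he : e i ≠ 0) : f i ≠ 0 := by
  intro hf
  refine he (D.eq_zero_of_bracket_f hsimple (D.e_mem i) (fun h => D.cartan_e h i)
    (subset_orbitSpan ⟨i, rfl⟩) fun j => ?_)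
  by_cases hj : j = i
  · rw [hj, hf]; simp
  · exact D.symm.e_f_ne j i hj

/-- The value `β k h` is read off from the action of `c h` on `e k ≠ 0`, so injectivity of `c` is
not needed. -/
theorem weight_eq_of_cartan_eq (D : IsChevalleySystem c β e f τ) {k : Fin n} (he : e k ≠ 0)
    {h h' : H} {r : ℂ} (hh : c h = r • c h') : β k h = r * β k h' := by
  refine smul_left_injective ℂ he ?_
  change β k h • e k = (r * β k h') • e k
  rw [← D.cartan_e, hh, map_smul, LinearMap.smul_apply, D.cartan_e, smul_smul]

theorem rescale (D : IsChevalleySystem c β e f τ) {r s : Fin n → ℂ} (hr : ∀ j, r j ≠ 0)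
    (hs : ∀ j, s j ≠ 0) :
    IsChevalleySystem c β (fun j => r j • e j) (fun j => s j • f j) τ where
  cartan_mem := D.cartan_mem
  cartan_cartan := D.cartan_cartan
  cartan_e h j := by rw [map_smul, D.cartan_e, smul_comm]
  cartan_f h j := by rw [map_smul, D.cartan_f, smul_comm]
  e_mem j := Submodule.smul_mem _ _ (D.e_mem j)
  f_mem j := Submodule.smul_mem _ _ (D.f_mem j)
  e_f_same j := by
    obtain ⟨h, hh⟩ := D.e_f_same j
    exact ⟨r j • s j • h, by simp [hh, smul_comm (r j)]⟩
  e_f_ne j k hjk := by simp [D.e_f_ne j k hjk]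
  generates := by
    intro S hS hbr
    refine D.generates S ?_ hbr
    rintro _ ((⟨h, rfl⟩ | ⟨j, rfl⟩) | ⟨j, rfl⟩)
    · exact hS (.inl (.inl ⟨h, rfl⟩))
    · exact (S.smul_mem_iff (hr j)).1 (hS (.inl (.inr ⟨j, rfl⟩)))
    · exact (S.smul_mem_iff (hs j)).1 (hS (.inr ⟨j, rfl⟩))
  linearIndependent := D.linearIndependent

/-! ### Odd reflection of a Chevalley system -/

section reflection

variable (β e f τ) (h : Fin n → H) (i : Fin n)

open Classical in
/-- The simple roots after odd reflection at `i`, where `h` are the coroots. -/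
def reflectRoot (h : H) (j : Fin n) : Module.Dual ℂ H :=
  if j = i then -β i else if β j h = 0 then β j else β j + β i

open Classical in
/-- The raising operators after odd reflection at `i`. -/
def reflectE (j : Fin n) : L :=
  if j = i then f i else if β j (h i) = 0 then e j else bracket (e i) (e j)

open Classical in
/-- The lowering operators after odd reflection at `i`. -/
def reflectF (j : Fin n) : L :=
  -- The sign and the scalar are chosen so that `[e' j, f' j]` is exactly `-h i`, `h j` or `h i + h
  -- j`.
  if j = i then -e i else if β j (h i) = 0 then f j
  else (superSign 1 (τ j) * (β j (h i))⁻¹) • bracket (f i) (f j)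

open Classical in
/-- The coroots after odd reflection at `i`. -/
def reflectCoroot (j : Fin n) : H :=
  if j = i then -h i else if β j (h i) = 0 then h j else h i + h j

open Classical in
/-- The parities after odd reflection at `i`. -/
def reflectParity (j : Fin n) : ZMod 2 := if β j (h i) = 0 then τ j else τ j + 1

variable {β e f τ h i}

/-- The span of the `n` new roots contains all old roots, hence has dimension at least `n`. -/
theorem linearIndependent_reflectRoot (hβ : LinearIndependent ℂ β) (h : H) :
    LinearIndependent ℂ (reflectRoot β i h) := by
  rw [linearIndependent_iff_card_le_finrank_span] at hβ ⊢
  refine hβ.trans ?_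
  have : FiniteDimensional ℂ (Submodule.span ℂ (Set.range (reflectRoot β i h))) :=
    FiniteDimensional.span_of_finite ℂ (Set.finite_range _)
  refine Submodule.finrank_mono (Submodule.span_le.2 ?_)
  have hmem : ∀ j, reflectRoot β i h j ∈ Submodule.span ℂ (Set.range (reflectRoot β i h)) :=
    fun j => Submodule.subset_span ⟨j, rfl⟩
  have hi : β i ∈ Submodule.span ℂ (Set.range (reflectRoot β i h)) := by
    have := hmem i
    rw [reflectRoot, if_pos rfl] at this
    exact neg_mem_iff.1 this
  rintro _ ⟨j, rfl⟩
  have := hmem j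
  rw [reflectRoot] at this
  split_ifs at this with h1 h2
  · rw [h1]; exact hi
  · exact this
  · have h3 := sub_mem this hi
    rwa [add_sub_cancel_right] at h3

variable (D : IsChevalleySystem c β e f τ) (hh : ∀ j, c (h j) = bracket (e j) (f j))
  (hτ : τ i = 1)
include D hh hτ

theorem bracket_f_e_of_odd : bracket (f i) (e i) = c (h i) := by
  rw [skew (D.f_mem i) (D.e_mem i), hτ, superSign_one_one, neg_one_smul, neg_neg, hh]

/-- Undoes `ad (e i)` up to a scalar; this yields generation by, and nonvanishing of, the reflected
vectors. -/
theorem bracket_f_e_e {k : Fin n} (hk : k ≠ i) :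
    bracket (f i) (bracket (e i) (e k)) = β k (h i) • e k := by
  rw [jacobi (D.f_mem i) (D.e_mem i), D.bracket_f_e_of_odd hh hτ, D.cartan_e,
    D.symm.e_f_ne i k hk.symm, map_zero, smul_zero, add_zero]

omit hτ in
theorem bracket_e_f_f {k : Fin n} (hk : k ≠ i) :
    bracket (e i) (bracket (f i) (f k)) = -(β k (h i) • f k) := by
  rw [jacobi (D.e_mem i) (D.f_mem i), ← hh, D.cartan_f, D.e_f_ne i k hk.symm, map_zero, smul_zero,
    add_zero, LinearMap.neg_apply, neg_smul]

omit hh hτ in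
theorem bracket_e_f_f_of_ne {j k : Fin n} (hj : j ≠ i) (hjk : j ≠ k) :
    bracket (e j) (bracket (f i) (f k)) = 0 := by
  rw [jacobi (D.e_mem j) (D.f_mem i), D.e_f_ne j i hj, D.e_f_ne j k hjk]; simp

theorem bracket_e_f_f_same {j : Fin n} (hj : j ≠ i) :
    bracket (e j) (bracket (f i) (f j)) = (superSign 1 (τ j) * β i (h j)) • f i := by
  rw [jacobi (D.e_mem j) (D.f_mem i), D.e_f_ne j i hj, ← hh, D.f_cartan, map_zero,
    LinearMap.zero_apply, zero_add, hτ, superSign_comm, smul_smul]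

/-- The expansion gives `h i` with coefficient `β i (h j)` and `h j` with coefficient `β j (h i)`,
up to a common sign. Symmetry makes these equal, so a single scalar factors out. -/
theorem bracket_ee_ff (hsymm : ∀ k, β k (h i) = β i (h k)) {j : Fin n} (hj : j ≠ i) :
    bracket (bracket (e i) (e j)) (bracket (f i) (f j)) =
      (superSign 1 (τ j) * β j (h i)) • c (h i + h j) := by
  rw [bracket_bracket (D.e_mem i) (D.e_mem j), D.bracket_e_f_f_same hh hτ hj,
    D.bracket_e_f_f hh hj, map_smul, ← hh, map_neg, map_smul, ← hh, hτ, smul_neg, sub_neg_eq_add,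
    smul_smul, ← hsymm, map_add, smul_add]

theorem cartan_reflectCoroot (hsymm : ∀ k, β k (h i) = β i (h k)) (j : Fin n) :
    c (reflectCoroot β h i j) = bracket (reflectE β e f h i j) (reflectF β e f τ h i j) := by
  rw [reflectCoroot, reflectE, reflectF]
  split_ifs with h1 h2
  · rw [map_neg, map_neg, D.bracket_f_e_of_odd hh hτ]
  · exact hh j
  · rw [map_smul, D.bracket_ee_ff hh hτ hsymm h1, smul_smul]
    have : superSign 1 (τ j) * (β j (h i))⁻¹ * (superSign 1 (τ j) * β j (h i)) = 1 := by
      rw [mul_mul_mul_comm, superSign_mul_self, inv_mul_cancel₀ h2, one_mul]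
    rw [this, one_smul]

variable (hsimple : ∀ S : Submodule ℂ L, IsGradedIdeal S → Disjoint S (LinearMap.range c) → S = ⊥)
include hsimple

omit hτ in
theorem bracket_f_f (hsymm : ∀ k, β k (h i) = β i (h k)) {k : Fin n} (hk : β k (h i) = 0) :
    bracket (f i) (f k) = 0 := by
  refine D.symm.bracket_e_e hsimple
    (hi := -(superSign (τ i) (τ i) • h i)) (hk := -(superSign (τ k) (τ k) • h k)) ?_ ?_ ?_ ?_
  · rw [skew (D.f_mem i) (D.e_mem i), map_neg, map_smul, hh]
  · rw [skew (D.f_mem k) (D.e_mem k), map_neg, map_smul, hh]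
  · simp [hk]
  · simp [← hsymm, hk]

/-- Odd reflection of Chevalley generators. -/
theorem reflect (hsymm : ∀ k, β k (h i) = β i (h k)) (hiso : β i (h i) = 0) :
    IsChevalleySystem c (reflectRoot β i (h i)) (reflectE β e f h i) (reflectF β e f τ h i)
      (reflectParity β τ h i) where
  cartan_mem := D.cartan_mem
  cartan_cartan := D.cartan_cartan
  cartan_e x j := by
    rw [reflectRoot, reflectE]
    split_ifs with h1 h2
    · exact D.cartan_f x i
    · exact D.cartan_e x j
    · rw [add_comm]
      exact D.bracket_weight (D.e_mem i) (fun x => D.cartan_e x i) (fun x => D.cartan_e x j) x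
  cartan_f x j := by
    rw [reflectRoot, reflectF]
    split_ifs with h1 h2
    · rw [neg_neg, map_neg, D.cartan_e, smul_neg]
    · exact D.cartan_f x j
    · rw [map_smul, neg_add_rev, smul_comm,
        ← D.bracket_weight (D.f_mem i) (fun x => D.cartan_f x i) (fun x => D.cartan_f x j) x]
  e_mem j := by
    rw [reflectParity, reflectE]
    split_ifs with h2 h1 h1
    · rw [h1]; exact D.f_mem i
    · exact D.e_mem j
    -- `reflectParity` has no separate case `j = i`: isotropy places it in the branch of unchanged
    -- parity.
    · exact absurd (h1 ▸ hiso) h2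
    · rw [add_comm, ← hτ]; exact LieSuperalgebra.bracket_mem (D.e_mem i) (D.e_mem j)
  f_mem j := by
    rw [reflectParity, reflectF]
    split_ifs with h2 h1 h1
    · rw [h1]; exact neg_mem (D.e_mem i)
    · exact D.f_mem j
    · exact absurd (h1 ▸ hiso) h2
    · rw [add_comm, ← hτ]
      exact Submodule.smul_mem _ _ (LieSuperalgebra.bracket_mem (D.f_mem i) (D.f_mem j))
  e_f_same j := ⟨_, D.cartan_reflectCoroot hh hτ hsymm j⟩
  e_f_ne j k hjk := by
    have hff : ∀ k, β k (h i) = 0 → bracket (f i) (f k) = 0 := fun k hk =>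
      D.bracket_f_f hh hsimple hsymm hk
    have hee : ∀ k, β k (h i) = 0 → bracket (e i) (e k) = 0 := fun k hk =>
      D.bracket_e_e hsimple (hh i) (hh k) hk (hsymm k ▸ hk)
    rw [reflectE, reflectF]
    by_cases hj : j = i
    · have hk : k ≠ i := fun hk => hjk (hj.trans hk.symm)
      rw [if_pos hj, if_neg hk]
      split_ifs with h2
      · exact hff k h2
      · rw [map_smul, jacobi (D.f_mem i) (D.f_mem i), hff i hiso, hτ, superSign_one_one,
          map_zero, LinearMap.zero_apply, zero_add, neg_one_smul]
        -- Since `f i` is odd and `[f i, f i] = 0`, the Jacobi identity reads `(ad (f i))² = -(ad (f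
        -- i))²`.
        have h3 : bracket (f i) (bracket (f i) (f k)) = 0 := by
          have := jacobi (D.f_mem i) (D.f_mem i) (z := f k)
          rw [hff i hiso, hτ, superSign_one_one, map_zero, LinearMap.zero_apply, zero_add,
            neg_one_smul] at this
          exact eq_zero_of_eq_neg this
        rw [h3, neg_zero, smul_zero]
    · rw [if_neg hj]
      by_cases hk : k = i
      · rw [if_pos hk, map_neg, neg_eq_zero]
        split_ifs with h2
        · rw [skew (D.e_mem j) (D.e_mem i), hee j h2, smul_zero, neg_zero]
        · have h3 : bracket (e i) (bracket (e i) (e j)) = 0 := by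
            have := jacobi (D.e_mem i) (D.e_mem i) (z := e j)
            rw [hee i hiso, hτ, superSign_one_one, map_zero, LinearMap.zero_apply, zero_add,
              neg_one_smul] at this
            exact eq_zero_of_eq_neg this
          rw [skew (LieSuperalgebra.bracket_mem (D.e_mem i) (D.e_mem j)) (D.e_mem i), h3,
            smul_zero, neg_zero]
      · rw [if_neg hk]
        split_ifs with h2 h3 h3
        · exact D.e_f_ne j k hjk
        · rw [map_smul, D.bracket_e_f_f_of_ne hj hjk, smul_zero]
        · rw [bracket_bracket (D.e_mem i) (D.e_mem j), D.e_f_ne j k hjk,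
            D.e_f_ne i k (Ne.symm hk)]
          simp
        · rw [map_smul, bracket_bracket (D.e_mem i) (D.e_mem j),
            D.bracket_e_f_f_of_ne hj hjk, D.bracket_e_f_f hh hk, map_neg, map_smul,
            D.e_f_ne j k hjk]
          simp
  generates := by
    intro S hS hbr
    have hE : ∀ j, reflectE β e f h i j ∈ S := fun j => hS (.inl (.inr ⟨j, rfl⟩))
    have hF : ∀ j, reflectF β e f τ h i j ∈ S := fun j => hS (.inr ⟨j, rfl⟩)
    have hfi : f i ∈ S := by simpa [reflectE] using hE i
    have hei : e i ∈ S := by simpa [reflectF] using hF i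
    refine D.generates S ?_ hbr
    rintro _ ((⟨x, rfl⟩ | ⟨j, rfl⟩) | ⟨j, rfl⟩)
    · exact hS (.inl (.inl ⟨x, rfl⟩))
    · have hj := hE j
      rw [reflectE] at hj
      split_ifs at hj with h1 h2
      · rw [h1]; exact hei
      · exact hj
      · have := hbr _ hfi _ hj
        rw [D.bracket_f_e_e hh hτ h1] at this
        exact (S.smul_mem_iff h2).1 this
    · have hj := hF j
      rw [reflectF] at hj
      split_ifs at hj with h1 h2
      · rw [h1]; exact hfi
      · exact hj
      · have hs : superSign 1 (τ j) ≠ 0 := fun h0 => by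
          simpa [h0] using superSign_mul_self 1 (τ j)
        have := hbr _ hei _ ((S.smul_mem_iff (mul_ne_zero hs (inv_ne_zero h2))).1 hj)
        rw [D.bracket_e_f_f hh h1] at this
        exact (S.smul_mem_iff h2).1 (neg_mem_iff.1 this)
  linearIndependent := linearIndependent_reflectRoot D.linearIndependent _

/-- Ensures that the reflected simple roots really are roots. -/
theorem reflectE_ne_zero (he : ∀ j, e j ≠ 0) (j : Fin n) : reflectE β e f h i j ≠ 0 := by
  rw [reflectE]
  split_ifs with h1 h2
  · exact D.f_ne_zero hsimple (he i)
  · exact he j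
  · intro h0
    have := D.bracket_f_e_e hh hτ h1
    rw [h0, map_zero] at this
    exact smul_ne_zero h2 (he j) this.symm

end reflection

end IsChevalleySystem

end LieSuperalgebra

/-! ### The generators of `g̃` as a Chevalley system -/

open LieSuperalgebra Contragredient

namespace Contragredient

variable {n : ℕ} {B : Matrix (Fin n) (Fin n) ℂ} {H : Type*} [AddCommGroup H] [Module ℂ H]
  (R : MinimalRealization B H) (τ : Fin n → ZMod 2)

theorem mkQ_eq_of_relator {x y : Free n H} (h : Relator R τ (x - y)) :
    (relationIdeal R τ).mkQ x = (relationIdeal R τ).mkQ y := by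
  rw [← sub_eq_zero, ← map_sub, Submodule.mkQ_apply, Submodule.Quotient.mk_eq_zero]
  exact relator_mem R τ h

theorem mkQ_eq_zero_of_relator {x : Free n H} (h : Relator R τ x) :
    (relationIdeal R τ).mkQ x = 0 := by
  rw [Submodule.mkQ_apply, Submodule.Quotient.mk_eq_zero]
  exact relator_mem R τ h

theorem tilde_generates :
    Generates (Set.range (tildeCartan R τ) ∪
      Set.range (fun i => (relationIdeal R τ).mkQ (freeE H i)) ∪
      Set.range (fun i => (relationIdeal R τ).mkQ (freeF H i))) := by
  intro S hS hbr
  have hword : ∀ w : FreeMagma (Gen n H),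
      (relationIdeal R τ).mkQ (MonoidAlgebra.ofMagma ℂ (FreeMagma (Gen n H)) w) ∈ S := by
    intro w
    induction w with
    | ih1 x =>
      cases x with
      | h h => exact hS (.inl (.inl ⟨h, rfl⟩))
      | e i => exact hS (.inl (.inr ⟨i, rfl⟩))
      | f i => exact hS (.inr ⟨i, rfl⟩)
    | ih2 u v hu hv =>
      have := hbr _ hu _ hv
      rwa [map_mul]
  rw [eq_top_iff]
  rintro x -
  obtain ⟨x, rfl⟩ := (relationIdeal R τ).mkQ_surjective x
  induction x using MonoidAlgebra.induction_linear with
  | zero => rw [map_zero]; exact zero_mem _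
  | add x y hx hy => rw [map_add]; exact add_mem hx hy
  | single w r =>
    have h : MonoidAlgebra.single w r
        = r • MonoidAlgebra.ofMagma ℂ (FreeMagma (Gen n H)) w := by
      simp [MonoidAlgebra.ofMagma]
    rw [h, map_smul]
    exact S.smul_mem _ (hword w)

/-- Makes `disjoint_sSup` available in `g̃`, so that `radical` itself meets the Cartan image
trivially. -/
theorem tilde_isChevalleySystem :
    IsChevalleySystem (tildeCartan R τ) R.root (fun i => (relationIdeal R τ).mkQ (freeE H i))
      (fun i => (relationIdeal R τ).mkQ (freeF H i)) τ where
  cartan_mem h := ⟨freeH n h, of_mem_freePart τ (.h h), rfl⟩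
  cartan_cartan h h' := mkQ_eq_zero_of_relator R τ (.h_h h h')
  cartan_e h j := mkQ_eq_of_relator R τ (.h_e h j)
  cartan_f h j := mkQ_eq_of_relator R τ (.h_f h j)
  e_mem j := ⟨freeE H j, of_mem_freePart τ (.e j), rfl⟩
  f_mem j := ⟨freeF H j, of_mem_freePart τ (.f j), rfl⟩
  e_f_same j := ⟨R.coroot j, (mkQ_eq_of_relator R τ (.e_f_same j)).symm⟩
  e_f_ne j k hjk := mkQ_eq_zero_of_relator R τ (.e_f_ne j k hjk)
  generates := tilde_generates R τ
  linearIndependent := R.linearIndependent_root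

end Contragredient

/-! ### Uniqueness of Chevalley generators and reflection in `g` -/

namespace ContragredientLieSuperalgebra

variable {n : ℕ} {B : Matrix (Fin n) (Fin n) ℂ} {H : Type*} [AddCommGroup H] [Module ℂ H]
  {R : MinimalRealization B H} {σ : Fin n → ZMod 2}

/-- The preimage of `S` in `g̃` meets the Cartan image inside `radical`, hence trivially; so it is
one of the ideals summed up in `radical`. -/
theorem eq_bot_of_disjoint_cartan (S : Submodule ℂ (ContragredientLieSuperalgebra R σ))
    (hS : IsGradedIdeal S) (hdis : Disjoint S (LinearMap.range (cartan R σ))) : S = ⊥ := by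
  have hrad : radical R σ ≤ S.comap (radical R σ).mkQ := fun x hx => by
    rw [Submodule.mem_comap, Submodule.mkQ_apply, (Submodule.Quotient.mk_eq_zero _).2 hx]
    exact zero_mem _
  have hgr : IsGradedIdeal (S.comap (radical R σ).mkQ) := by
    refine ⟨fun x y hy => hS.bracket_mem ((radical R σ).mkQ x) _ hy, fun x hx => ?_⟩
    obtain ⟨_, ⟨hu, ⟨u, hup, rfl⟩⟩, _, ⟨hv, ⟨v, hvp, rfl⟩⟩, huv⟩ :=
      Submodule.mem_sup.1 (hS.graded hx)
    -- Lifts of the graded components add up to `x` only modulo `radical`, which is itself graded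
    -- and contained in the preimage.
    have hmem : x - (u + v) ∈ radical R σ := by
      rw [← Submodule.Quotient.mk_eq_zero, ← Submodule.mkQ_apply, map_sub, map_add, huv, sub_self]
    have hr := (isGradedIdeal_radical R σ).graded.trans
      (sup_le_sup (inf_le_inf_right _ hrad) (inf_le_inf_right _ hrad)) hmem
    rw [← sub_add_cancel x (u + v)]
    exact add_mem hr (add_mem (Submodule.mem_sup_left ⟨hu, hup⟩)
      (Submodule.mem_sup_right ⟨hv, hvp⟩))
  have hle : S.comap (radical R σ).mkQ ≤ radical R σ := by
    refine le_sSup ⟨hgr, ?_⟩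
    rw [Submodule.disjoint_def]
    rintro _ hx ⟨h, rfl⟩
    have h0 : (radical R σ).mkQ (tildeCartan R σ h) = 0 :=
      Submodule.disjoint_def.1 hdis _ hx ⟨h, rfl⟩
    rw [Submodule.mkQ_apply, Submodule.Quotient.mk_eq_zero] at h0
    exact Submodule.disjoint_def.1 (tilde_isChevalleySystem R σ).disjoint_sSup _ h0 ⟨h, rfl⟩
  rw [eq_bot_iff]
  intro x hx
  obtain ⟨x, rfl⟩ := (radical R σ).mkQ_surjective x
  exact (Submodule.Quotient.mk_eq_zero _).2 (hle hx)

variable {β : Fin n → Module.Dual ℂ H} {e f e₂ f₂ : Fin n → ContragredientLieSuperalgebra R σ}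
  {τ : Fin n → ZMod 2}

theorem IsChevalley.isChevalleySystem (hC : IsChevalley R σ β e f)
    (he : ∀ j, e j ∈ part (L := ContragredientLieSuperalgebra R σ) (τ j))
    (hf : ∀ j, f j ∈ part (L := ContragredientLieSuperalgebra R σ) (τ j))
    (hh : ∀ j, ∃ h, cartan R σ h = bracket (e j) (f j)) :
    IsChevalleySystem (cartan R σ) β e f τ where
  cartan_mem h := ⟨_, (tilde_isChevalleySystem R σ).cartan_mem h, rfl⟩
  cartan_cartan h h' := by
    change (radical R σ).mkQ (bracket (tildeCartan R σ h) (tildeCartan R σ h')) = 0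
    rw [(tilde_isChevalleySystem R σ).cartan_cartan, map_zero]
  cartan_e h j := hC.e_mem j h
  cartan_f h j := hC.f_mem j h
  e_mem := he
  f_mem := hf
  e_f_same := hh
  e_f_ne := hC.bracket_e_f
  generates := hC.generates
  linearIndependent := hC.linearIndependent

theorem HasCartanDatum.isChevalleySystem {C : CartanDatum n} (hC : HasCartanDatum R σ β e f C) :
    IsChevalleySystem (cartan R σ) β e f C.τ := by
  obtain ⟨h, hh, -⟩ := hC.matrix_eq
  exact hC.isChevalley.isChevalleySystem hC.e_parity hC.f_parity fun j => ⟨h j, hh j⟩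

theorem isChevalley_of_isChevalleySystem (D : IsChevalleySystem (cartan R σ) β e f τ)
    (he : ∀ j, e j ≠ 0) : IsChevalley R σ β e f where
  linearIndependent := D.linearIndependent
  isRoot j := ⟨D.linearIndependent.ne_zero j, fun h0 => he j <| by
    have : e j ∈ rootSpace R σ (β j) := fun h => D.cartan_e h j
    rwa [h0, Submodule.mem_bot] at this⟩
  e_mem j h := D.cartan_e h j
  f_mem j h := D.cartan_f h j
  generates := D.generates
  bracket_e_f := D.e_f_ne

theorem e_ne_zero (D : IsChevalleySystem (cartan R σ) β e f τ) {j : Fin n}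
    (hβ : IsRoot R σ (β j)) : e j ≠ 0 := by
  intro h0
  refine hβ.2 (eq_bot_iff.2 fun x hx => ?_)
  have := D.mem_span_of_weight (i := j) hx
  rwa [h0, Submodule.span_zero_singleton] at this

/-- Chevalley generators are unique up to non-zero scalars. -/
theorem exists_smul_eq (D : IsChevalleySystem (cartan R σ) β e f τ)
    (hC : IsChevalley R σ β e₂ f₂) :
    ∃ r s : Fin n → ℂ, (∀ j, r j ≠ 0) ∧ (∀ j, s j ≠ 0) ∧ (∀ j, e₂ j = r j • e j) ∧
      ∀ j, f₂ j = s j • f j := by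
  have he : ∀ j, ∃ r : ℂ, r • e j = e₂ j := fun j =>
    Submodule.mem_span_singleton.1 (D.mem_span_of_weight (hC.e_mem j))
  have hf : ∀ j, ∃ s : ℂ, s • f j = f₂ j := fun j =>
    Submodule.mem_span_singleton.1 (D.symm.mem_span_of_weight (hC.f_mem j))
  choose r hr using he
  choose s hs using hf
  -- `IsChevalley` does not include homogeneity or coroots; both are inherited through
  -- proportionality to `e` and `f`.
  have D₂ : IsChevalleySystem (cartan R σ) β e₂ f₂ τ := by
    refine hC.isChevalleySystem (fun j => ?_) (fun j => ?_) fun j => ?_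
    · rw [← hr]; exact Submodule.smul_mem _ _ (D.e_mem j)
    · rw [← hs]; exact Submodule.smul_mem _ _ (D.f_mem j)
    · obtain ⟨h, hh⟩ := D.e_f_same j
      exact ⟨r j • s j • h, by simp [← hr, ← hs, hh, smul_comm (r j)]⟩
  have he₂ : ∀ j, e₂ j ≠ 0 := fun j => e_ne_zero D₂ (hC.isRoot j)
  refine ⟨r, s, fun j h0 => he₂ j ?_, fun j h0 => ?_, fun j => (hr j).symm, fun j => (hs j).symm⟩
  · rw [← hr, h0, zero_smul]
  · refine D₂.f_ne_zero eq_bot_of_disjoint_cartan (he₂ j) ?_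
    rw [← hs, h0, zero_smul]

variable {C C₂ : CartanDatum n}

/-- Rescaling generators by `r j` and `s j` rescales the coroot by their product. This makes
isotropy, vanishing of entries and symmetrizability independent of the choice of generators. -/
theorem HasCartanDatum.exists_weight_eq_mul (hC : HasCartanDatum R σ β e f C)
    (hC₂ : IsChevalley R σ β e₂ f₂) :
    ∃ d : Fin n → ℂ, (∀ j, d j ≠ 0) ∧ ∀ j h, cartan R σ h = bracket (e₂ j) (f₂ j) →
      ∀ k, β k h = d j * C.B j k := by
  obtain ⟨r, s, hr, hs, her, hfs⟩ := exists_smul_eq hC.isChevalleySystem hC₂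
  obtain ⟨h₁, hh₁, hB⟩ := hC.matrix_eq
  refine ⟨fun j => s j * r j, fun j => mul_ne_zero (hs j) (hr j), fun j h hh k => ?_⟩
  rw [hB]
  refine hC.isChevalleySystem.weight_eq_of_cartan_eq
    (e_ne_zero hC.isChevalleySystem (hC.isChevalley.isRoot k)) ?_
  rw [hh, hh₁, her, hfs, map_smul, map_smul, LinearMap.smul_apply, smul_smul]

theorem HasCartanDatum.isSymmetrizable (hC : HasCartanDatum R σ β e f C)
    (hC₂ : HasCartanDatum R σ β e₂ f₂ C₂) (hsymm : C.IsSymmetrizable) : C₂.IsSymmetrizable := by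
  obtain ⟨d, hd, hdC⟩ := hC.exists_weight_eq_mul hC₂.isChevalley
  obtain ⟨h₂, hh₂, hB₂⟩ := hC₂.matrix_eq
  obtain ⟨t, ht, htC⟩ := hsymm
  refine ⟨fun j => t j * (d j)⁻¹, fun j => mul_ne_zero (ht j) (inv_ne_zero (hd j)), ?_⟩
  convert htC using 1
  ext j k
  rw [Matrix.diagonal_mul, Matrix.diagonal_mul, hB₂, hdC j _ (hh₂ j), mul_assoc,
    inv_mul_cancel_left₀ (hd j)]

/-- The symmetrizing row scalars are absorbed into the `e j`, with the `f j` kept. -/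
theorem HasCartanDatum.exists_isSymm (hC : HasCartanDatum R σ β e f C)
    (hsymm : C.IsSymmetrizable) :
    ∃ e' f' C', HasCartanDatum R σ β e' f' C' ∧ C'.B.IsSymm := by
  obtain ⟨d, hd, hdC⟩ := hsymm
  obtain ⟨h, hh, hB⟩ := hC.matrix_eq
  have D := hC.isChevalleySystem.rescale hd (fun _ => one_ne_zero)
  refine ⟨_, _, ⟨Matrix.diagonal d * C.B, C.τ⟩, ⟨isChevalley_of_isChevalleySystem D fun j =>
    smul_ne_zero (hd j) (e_ne_zero hC.isChevalleySystem (hC.isChevalley.isRoot j)),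
    D.e_mem, D.f_mem, fun j => d j • h j, fun j => ?_, fun j k => ?_⟩, hdC⟩
  · rw [map_smul, hh, one_smul, map_smul, LinearMap.smul_apply]
  · change (Matrix.diagonal d * C.B) j k = β k (d j • h j)
    rw [Matrix.diagonal_mul, hB, map_smul, smul_eq_mul]

theorem HasCartanDatum.reflect {β' : Fin n → Module.Dual ℂ H} {i : Fin n}
    (hC : HasCartanDatum R σ β e f C) (hsymm : C.B.IsSymm)
    (hβ' : IsOddReflection R σ β i β') :
    ∃ e' f', HasCartanDatum R σ β' e' f' (C.oddReflection i) := by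
  obtain ⟨⟨hodd, x, ⟨ex, fx, hex, hx⟩, hx0⟩, y, ⟨ey, fy, hey, hy⟩, hβ'⟩ := hβ'
  have D := hC.isChevalleySystem
  have he : ∀ j, e j ≠ 0 := fun j => e_ne_zero D (hC.isChevalley.isRoot j)
  obtain ⟨h, hh, hB⟩ := hC.matrix_eq
  have hiso : β i (h i) = 0 := by
    obtain ⟨d, hd, hdC⟩ := hC.exists_weight_eq_mul hex
    rw [hdC i x hx] at hx0
    rw [← hB]
    exact (mul_eq_zero.1 hx0).resolve_left (hd i)
  have hy0 : ∀ k, β k y = 0 ↔ β k (h i) = 0 := by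
    obtain ⟨d, hd, hdC⟩ := hC.exists_weight_eq_mul hey
    intro k
    rw [hdC i y hy, mul_eq_zero, or_iff_right (hd i), hB]
  have hsy : ∀ j k, β k (h j) = β j (h k) := fun j k => by rw [← hB, ← hB, hsymm.apply]
  -- Were `e i` even, it would lie in both graded parts and vanish.
  have hτ : C.τ i = 1 := by
    have h01 : ∀ a : ZMod 2, a = 0 ∨ a = 1 := by decide
    refine (h01 (C.τ i)).resolve_left fun h0 => he i ?_
    exact Submodule.disjoint_def.1 isCompl_part.disjoint _ (h0 ▸ D.e_mem i)
      (hodd (hC.isChevalley.e_mem i))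
  have hβeq : β' = IsChevalleySystem.reflectRoot β i (h i) := by
    funext j
    rw [hβ', IsChevalleySystem.reflectRoot]
    simp only [hy0]
  have hτeq : (C.oddReflection i).τ = IsChevalleySystem.reflectParity β C.τ h i := by
    funext j
    simp only [CartanDatum.oddReflection, IsChevalleySystem.reflectParity, hB]
  have D' := D.reflect hh hτ eq_bot_of_disjoint_cartan (hsy i) hiso
  rw [← hβeq, ← hτeq] at D'
  refine ⟨_, _, isChevalley_of_isChevalleySystem D' fun j =>
    D.reflectE_ne_zero hh hτ eq_bot_of_disjoint_cartan he j, D'.e_mem, D'.f_mem,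
    IsChevalleySystem.reflectCoroot β h i, D.cartan_reflectCoroot hh hτ (hsy i), fun j k => ?_⟩
  rw [hβeq]
  simp only [CartanDatum.oddReflection, IsChevalleySystem.reflectRoot,
    IsChevalleySystem.reflectCoroot, Matrix.of_apply, hB, mul_eq_zero, hsy j i]
  by_cases hj : j = i
  · subst hj
    by_cases hk : k = j
    · simp [hk, hiso]
    · by_cases hk0 : β k (h j) = 0 <;> simp [hk, hk0, hiso]
  · by_cases hk : k = i
    · subst hk
      by_cases hj0 : β j (h k) = 0 <;> simp [hj, hj0, hiso, hsy j k]
    -- When both entries are nonzero, `(β k + β i) (h i + h j)` has four terms, of which `β i (h i)`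
    -- vanishes. If just one is nonzero, the single extra term vanishes, by symmetry when it is `β i
    -- (h j)`.
    · by_cases hj0 : β j (h i) = 0 <;> by_cases hk0 : β k (h i) = 0 <;>
        simp [hj, hk, hj0, hk0, hiso, hsy j i]
      ring

end ContragredientLieSuperalgebra

/-- For symmetric `B` the correction `b_ik + b_ji` is invariant under exchanging `j` and `k`, so the
new matrix is symmetric without rescaling. -/
theorem CartanDatum.isSymmetrizable_oddReflection {n : ℕ} {C : CartanDatum n} (hC : C.B.IsSymm)
    (i : Fin n) : (C.oddReflection i).IsSymmetrizable := by
  refine ⟨fun _ => 1, fun _ => one_ne_zero, ?_⟩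
  rw [Matrix.diagonal_one, one_mul]
  ext j k
  simp only [Matrix.transpose_apply, CartanDatum.oddReflection, Matrix.of_apply, hC.apply j k,
    hC.apply i k, hC.apply i j, or_comm (a := k = i), mul_comm (C.B i k)]
  split_ifs
  · rfl
  · rfl
  · ring

end

open ContragredientLieSuperalgebra in
theorem mainTheorem5 {n : ℕ} (C₀ : CartanDatum n) {H : Type*} [AddCommGroup H] [Module ℂ H]
    (R : MinimalRealization C₀.B H) :
    (∀ (β β' : Fin n → Module.Dual ℂ H) (i : Fin n),
      IsOddReflection R C₀.τ β i β' →
      ∀ (e f : Fin n → ContragredientLieSuperalgebra R C₀.τ) (C : CartanDatum n),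
        HasCartanDatum R C₀.τ β e f C → C.B.IsSymm →
        ∃ e' f' : Fin n → ContragredientLieSuperalgebra R C₀.τ,
          HasCartanDatum R C₀.τ β' e' f' (C.oddReflection i)) ∧
    (∀ β β' : Fin n → Module.Dual ℂ H,
      Relation.ReflTransGen (fun γ γ' => ∃ i, IsOddReflection R C₀.τ γ i γ') β β' →
      (∃ e f C, HasCartanDatum R C₀.τ β e f C ∧ C.IsSymmetrizable) →
      (∃ e' f' C', HasCartanDatum R C₀.τ β' e' f' C') ∧
      ∀ (e' f' : Fin n → ContragredientLieSuperalgebra R C₀.τ) (C' : CartanDatum n),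
        HasCartanDatum R C₀.τ β' e' f' C' → C'.IsSymmetrizable) := by
  refine ⟨fun β β' i hβ' e f C hC hsymm => hC.reflect hsymm hβ', fun β β' hchain hC => ?_⟩
  -- One symmetrizable datum for `β'` suffices, since any other differs from it by row scaling.
  have key : ∃ e f C, HasCartanDatum R C₀.τ β' e f C ∧ C.IsSymmetrizable := by
    induction hchain with
    | refl => exact hC
    | tail _ hstep ih =>
      obtain ⟨i, hi⟩ := hstep
      obtain ⟨e, f, C, hC, hsymm⟩ := ih
      obtain ⟨e₁, f₁, C₁, hC₁, hsymm₁⟩ := hC.exists_isSymm hsymm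
      obtain ⟨e', f', hC'⟩ := hC₁.reflect hsymm₁ hi
      exact ⟨e', f', _, hC', CartanDatum.isSymmetrizable_oddReflection hsymm₁ i⟩
  obtain ⟨e, f, C, hC', hsymm⟩ := key
  exact ⟨⟨e, f, C, hC'⟩, fun e' f' C' h => hC'.isSymmetrizable h hsymm⟩
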